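/- Let $k$ be a field of characteristic $0$ and $\beta\in k$ (for instance $k=\mathbb{C}(\beta)$). Let $\Lambda$ be the $k$-algebra of symmetric functions in $x=(x_1,x_2,\dots)$, with Schur functions $s_\lambda$ and power sums $p_n$, let $M_n\subset\Lambda$ be the span of the $s_\lambda$ with $\ell(\lambda)\ge n$, and let $\widehat\Lambda=\varprojlim_n\Lambda/M_n$. Then: (0) There is exactly one $k$-bilinear form $\langle\cdot,\cdot\rangle:\widehat\Lambda\times\Lambda\to k$ that is continuous in the first variable and satisfies $\langle s_\lambda,s_\mu\rangle=\delta_{\lambda\mu}$ (the extended Hall inner product). For every partition $\lambda$ there is exactly one $G_\lambda\in\widehat\Lambda$ (the stable Grothendieck polynomial) such that, for all $n\ge\ell(\lambda)$, $$G_\lambda(x_1,\dots,x_n,0,0,\dots)=\frac{\det\bigl(x_i^{\lambda_j+n-j}(1+\beta x_i)^{j-1}\bigr)_{1\le i,j\le n}}{\prod_{1\le i<j\le n}(x_i-x_j)}.$$ Let $\psi_n,\psi_n^*$ $(n\in\mathbb{Z})$ be the free fermions, $[\psi_m,\psi_n]_+=[\psi^*_m,\psi^*_n]_+=0$, $[\psi_m,\psi^*_n]_+=\delta_{mn}$,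 acting on the Fock space (semi-infinite wedges) with vacuum $|0\rangle=v_{-1}\wedge v_{-2}\wedge\cdots$; let $\langle 0|v\rangle$ be the coefficient of $|0\rangle$ in $v$, and put $|-r\rangle=\psi^*_{-r}\cdots\psi^*_{-2}\psi^*_{-1}|0\rangle$, $a_m=\sum_{j\in\mathbb{Z}}{:}\psi_j\psi^*_{j+m}{:}$, $H(x)=\sum_{n>0}\frac{p_n(x)}{n}a_n$ and $\theta=\sum_{n>0}(-1)^{n-1}\frac{\beta^n}{n}a_n$. For a partition $\mu$ and $r\ge\ell(\mu)$ (with $\mu_i=0$ for $i>\ell(\mu)$) set $$g_\mu(x)=\langle 0|\,e^{H(x)}\,\psi_{\mu_1-1}e^{-\theta}\,\psi_{\mu_2-2}e^{-\theta}\cdots\psi_{\mu_r-r}e^{-\theta}\,|-r\rangle\in\Lambda .$$ (1) For all partitions $\lambda,\mu$ and every $r\ge\ell(\mu)$, $\langle G_\lambda,g_\mu\rangle=\delta_{\lambda\mu}$. (2) Hence $g_\mu$ is the dual stable Grothendieck polynomial: for each $\mu$ (and every $r\ge\ell(\mu)$), $g_\mu$ is the only $f\in\Lambda$ with $\langle G_\lambda,f\rangle=\delta_{\lambda\mu}$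 for all partitions $\lambda$. -/

import Mathlib

noncomputable section

namespace StableGrothendieck

/-! ## Symmetric functions

Throughout, `k` is the ground field, and the variable `x_{i+1}` is `X i`, `i : ℕ`.
Partitions are Young diagrams: `μ.rowLen i` is the part `μ_{i+1}` (zero past the length)
and `μ.colLen 0` is the length `ℓ(μ)`. -/

/-- The `k`-algebra `Λ` of symmetric functions in `x_1, x_2, …`: the formal power series of
bounded degree whose coefficients are invariant under permutations of the variables. -/
def symSubalgebra (k : Type*) [Field k] : Subalgebra k (MvPowerSeries ℕ k) where
  carrier := {f | (∀ (σ : Equiv.Perm ℕ) (d : ℕ →₀ ℕ),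
      MvPowerSeries.coeff (Finsupp.equivMapDomain σ d) f = MvPowerSeries.coeff d f) ∧
    ∃ N : ℕ, ∀ d : ℕ →₀ ℕ, N < d.degree → MvPowerSeries.coeff d f = 0}
  mul_mem' := by
    classical
    rintro f g ⟨hf, N, hN⟩ ⟨hg, M, hM⟩
    refine ⟨fun σ d => ?_, N + M, fun d hd => ?_⟩
    · rw [MvPowerSeries.coeff_mul, MvPowerSeries.coeff_mul]
      symm
      refine Finset.sum_bij'
        (fun p _ => (Finsupp.equivMapDomain σ p.1, Finsupp.equivMapDomain σ p.2))
        (fun p _ => (Finsupp.equivMapDomain σ.symm p.1, Finsupp.equivMapDomain σ.symm p.2))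
        ?_ ?_ ?_ ?_ ?_
      · rintro ⟨a, b⟩ h
        rw [Finset.HasAntidiagonal.mem_antidiagonal] at h ⊢
        ext i
        simp [← h]
      · rintro ⟨a, b⟩ h
        rw [Finset.HasAntidiagonal.mem_antidiagonal] at h ⊢
        ext i
        simpa using DFunLike.congr_fun h (σ i)
      · rintro ⟨a, b⟩ _
        ext i <;> simp
      · rintro ⟨a, b⟩ _
        ext i <;> simp
      · rintro ⟨a, b⟩ _
        simp [hf, hg]
    · rw [MvPowerSeries.coeff_mul]
      refine Finset.sum_eq_zero fun p hp => ?_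
      rw [Finset.HasAntidiagonal.mem_antidiagonal] at hp
      have h : p.1.degree + p.2.degree = d.degree := by rw [← hp, map_add]
      rcases Nat.lt_or_ge N p.1.degree with h1 | h1
      · rw [hN _ h1, zero_mul]
      · rw [hM _ (by omega), mul_zero]
  add_mem' := by
    rintro f g ⟨hf, N, hN⟩ ⟨hg, M, hM⟩
    refine ⟨fun σ d => by simp [hf, hg], max N M, fun d hd => ?_⟩
    rw [max_lt_iff] at hd
    simp [hN d hd.1, hM d hd.2]
  algebraMap_mem' := by
    classical
    intro c
    refine ⟨fun σ d => ?_, 0, fun d hd => ?_⟩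
    · have h : Finsupp.equivMapDomain σ d = 0 ↔ d = 0 := by
        refine ⟨fun h => ?_, fun h => by ext; simp [h]⟩
        ext i
        simpa using DFunLike.congr_fun h (σ i)
      simp only [MvPowerSeries.algebraMap_apply, MvPowerSeries.coeff_C, h]
    · have h : d ≠ 0 := by rintro rfl; simp at hd
      simp [MvPowerSeries.algebraMap_apply, MvPowerSeries.coeff_C, h]

/-- The algebra `Λ` as a type. -/
def SymFun (k : Type*) [Field k] : Type _ := symSubalgebra k

instance (k : Type*) [Field k] : CommRing (SymFun k) := inferInstanceAs (CommRing (symSubalgebra k))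

instance (k : Type*) [Field k] : Algebra k (SymFun k) :=
  inferInstanceAs (Algebra k (symSubalgebra k))

/-- The complete symmetric function `h_n`, the sum of all monomials of degree `n`. -/
def completeSym (k : Type*) [Field k] (n : ℕ) : SymFun k :=
  ⟨fun d => if d.degree = n then 1 else 0, by
    refine ⟨fun σ d => ?_, n, fun d hd => if_neg (ne_of_gt hd)⟩
    have h : (Finsupp.equivMapDomain σ d).degree = d.degree := by
      rw [Finsupp.equivMapDomain_eq_mapDomain, Finsupp.degree_mapDomain]
    change (if (Finsupp.equivMapDomain σ d).degree = n then (1 : k) else 0) =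
      if d.degree = n then 1 else 0
    rw [h]⟩

open Classical in
/-- The power sum `p_n = ∑ᵢ xᵢⁿ` (used for `n ≥ 1` only). -/
def powerSum (k : Type*) [Field k] (n : ℕ) : SymFun k :=
  ⟨fun d => if ∃ i, d = Finsupp.single i n then 1 else 0, by
    refine ⟨fun σ d => ?_, n, fun d hd => if_neg ?_⟩
    · have h : (∃ i, Finsupp.equivMapDomain σ d = Finsupp.single i n) ↔
          ∃ i, d = Finsupp.single i n := by
        constructor
        · rintro ⟨i, hi⟩
          refine ⟨σ.symm i, ?_⟩
          rw [← Finsupp.equivMapDomain_single, ← hi, ← Finsupp.equivMapDomain_trans]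
          simp
        · rintro ⟨i, rfl⟩
          exact ⟨σ i, Finsupp.equivMapDomain_single _ _ _⟩
      change (if _ then (1 : k) else 0) = if _ then 1 else 0
      simp only [h]
    · rintro ⟨i, rfl⟩
      simp at hd⟩

/-- `h_z` for an integer index, with `h_z = 0` for `z < 0`. -/
def completeSymInt (k : Type*) [Field k] (z : ℤ) : SymFun k :=
  if 0 ≤ z then completeSym k z.toNat else 0

/-- The Schur function `s_μ = det (h_{μ_i - i + j})_{1 ≤ i, j ≤ ℓ(μ)}`. -/
def schur (k : Type*) [Field k] (μ : YoungDiagram) : SymFun k :=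
  (Matrix.of fun i j : Fin (μ.colLen 0) =>
    completeSymInt k ((μ.rowLen i : ℤ) - (i : ℤ) + (j : ℤ))).det

/-- The restriction `f ↦ f(x_1, …, x_n, 0, 0, …)`. -/
def restrict (k : Type*) [Field k] (n : ℕ) : SymFun k →ₗ[k] MvPowerSeries (Fin n) k where
  toFun f := fun d => MvPowerSeries.coeff (d.mapDomain Fin.val) f.1
  map_add' f g := by rfl
  map_smul' c f := by rfl

/-- The subspace `M_n` of `Λ` spanned by the Schur functions `s_μ` with `ℓ(μ) ≥ n`. -/
def longPart (k : Type*) [Field k] (n : ℕ) : Submodule k (SymFun k) :=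
  Submodule.span k {f | ∃ μ : YoungDiagram, n ≤ μ.colLen 0 ∧ f = schur k μ}

lemma longPart_succ_le (k : Type*) [Field k] (n : ℕ) : longPart k (n + 1) ≤ longPart k n :=
  Submodule.span_mono fun _ ⟨μ, h, e⟩ => ⟨μ, by omega, e⟩

/-- The completion `Λ̂ = lim Λ / M_n`. (The quotient with `n = 0` is zero and changes nothing.) -/
def CompletedSymFun (k : Type*) [Field k] : Submodule k (∀ n, SymFun k ⧸ longPart k n) where
  carrier := {F | ∀ n, Submodule.factor (longPart_succ_le k n) (F (n + 1)) = F n}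
  add_mem' := by intro F G hF hG n; simp [hF n, hG n]
  zero_mem' := by intro n; simp
  smul_mem' := by intro c F hF n; simp [hF n]

/-- The natural map `Λ → Λ̂`. -/
def toCompleted (k : Type*) [Field k] : SymFun k →ₗ[k] CompletedSymFun k where
  toFun f := ⟨fun n => (longPart k n).mkQ f, fun n => by simp⟩
  map_add' f g := by ext n; simp
  map_smul' c f := by ext n; simp

open Classical in
/-- `B : Λ̂ × Λ → k` is bilinear, restricts on `Λ × Λ` to the form for which the Schur functions
are orthonormal, and is continuous in the first variable: `k` is discrete, and the sets
`{F | F_n = 0}` form a neighbourhood base of `0` in `Λ̂`. -/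
def IsHallPairing (k : Type*) [Field k] (B : CompletedSymFun k →ₗ[k] SymFun k →ₗ[k] k) : Prop :=
  (∀ μ ν : YoungDiagram, B (toCompleted k (schur k μ)) (schur k ν) = if μ = ν then 1 else 0) ∧
  ∀ f : SymFun k, ∃ n : ℕ, ∀ F : CompletedSymFun k, F.1 n = 0 → B F f = 0

/-- The Hall inner product, extended to `Λ̂ × Λ`: the form described by `IsHallPairing`. -/
def hallPairing (k : Type*) [Field k] : CompletedSymFun k →ₗ[k] SymFun k →ₗ[k] k :=
  Classical.epsilon (IsHallPairing k)

/-- The numerator `det (x_i^{μ_j + n - j} (1 + β x_i)^{j - 1})_{1 ≤ i, j ≤ n}`. -/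
def grothendieckNumerator (k : Type*) [Field k] (β : k) (μ : YoungDiagram) (n : ℕ) :
    MvPowerSeries (Fin n) k :=
  (Matrix.of fun i j : Fin n =>
    (MvPowerSeries.X i : MvPowerSeries (Fin n) k) ^ (μ.rowLen j + (n - 1 - (j : ℕ))) *
      (1 + MvPowerSeries.C β * MvPowerSeries.X i) ^ (j : ℕ)).det

/-- The denominator `∏_{1 ≤ i < j ≤ n} (x_i - x_j)`. -/
def grothendieckDenominator (k : Type*) [Field k] (n : ℕ) : MvPowerSeries (Fin n) k :=
  ∏ i : Fin n, ∏ j ∈ Finset.Ioi i, (MvPowerSeries.X i - MvPowerSeries.X j)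

/-- `G ∈ Λ̂` satisfies `G(x_1, …, x_n, 0, …) = G_μ(x_1, …, x_n)` for all `n ≥ ℓ(μ)`, where
`G_μ(x_1, …, x_n)` is numerator over denominator. The restriction of `G` to `n` variables is that
of any lift of its component in `Λ / M_{n+1}`. -/
def IsStableGrothendieck (k : Type*) [Field k] (β : k) (μ : YoungDiagram)
    (G : CompletedSymFun k) : Prop :=
  ∀ n : ℕ, μ.colLen 0 ≤ n → ∀ u : SymFun k, (longPart k (n + 1)).mkQ u = G.1 (n + 1) →
    restrict k n u * grothendieckDenominator k n = grothendieckNumerator k β μ n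

/-- The stable Grothendieck polynomial `G_μ(x) ∈ Λ̂`: the element described by
`IsStableGrothendieck`. -/
def stableGrothendieck (k : Type*) [Field k] (β : k) (μ : YoungDiagram) : CompletedSymFun k :=
  Classical.epsilon (IsStableGrothendieck k β μ)

/-! ## Free fermions -/

/-- The index set `{i_1 > i_2 > ⋯}` of a semi-infinite wedge `v_{i_1} ∧ v_{i_2} ∧ ⋯`: it is bounded
above and contains all sufficiently negative integers. -/
@[ext]
structure Maya where
  /-- the set of indices -/
  carrier : Set ℤ
  finite_nonneg : {i | i ∈ carrier ∧ 0 ≤ i}.Finite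
  finite_neg : {i | i ∉ carrier ∧ i < 0}.Finite

namespace Maya

/-- The index set of the vacuum `v_{-1} ∧ v_{-2} ∧ ⋯`. -/
def vacuum : Maya where
  carrier := {i | i < 0}
  finite_nonneg := by
    convert Set.finite_empty
    ext i; simp
  finite_neg := by
    convert Set.finite_empty
    ext i; simp

/-- Add an index. -/
def insert (S : Maya) (j : ℤ) : Maya where
  carrier := {i | i = j ∨ i ∈ S.carrier}
  finite_nonneg := (S.finite_nonneg.union (Set.finite_singleton j)).subset fun i => by
    simp only [Set.mem_ofPred_eq, Set.mem_union, Set.mem_singleton_iff]; tauto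
  finite_neg := S.finite_neg.subset fun i => by
    simp only [Set.mem_ofPred_eq]; tauto

/-- Remove an index. -/
def erase (S : Maya) (j : ℤ) : Maya where
  carrier := {i | i ≠ j ∧ i ∈ S.carrier}
  finite_nonneg := S.finite_nonneg.subset fun i => by
    simp only [Set.mem_ofPred_eq]; tauto
  finite_neg := (S.finite_neg.union (Set.finite_singleton j)).subset fun i => by
    simp only [Set.mem_ofPred_eq, Set.mem_union, Set.mem_singleton_iff]; tauto

/-- The (finite) number of indices greater than `j`. -/
def above (S : Maya) (j : ℤ) : ℕ := {i | i ∈ S.carrier ∧ j < i}.ncard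

end Maya

/-- The fermionic Fock space with scalars in `R`, realised on semi-infinite wedges. -/
abbrev Fock (R : Type*) [CommRing R] : Type _ := Maya →₀ R

open Classical in
/-- `ψ_n`: the wedge product with `v_n` from the left. -/
def psi (R : Type*) [CommRing R] (n : ℤ) : Module.End R (Fock R) :=
  Finsupp.linearCombination R fun S : Maya =>
    if n ∈ S.carrier then 0 else Finsupp.single (S.insert n) ((-1 : R) ^ S.above n)

open Classical in
/-- `ψ*_n`: the contraction with the coordinate functional of `v_n`. -/
def psiStar (R : Type*) [CommRing R] (n : ℤ) : Module.End R (Fock R) :=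
  Finsupp.linearCombination R fun S : Maya =>
    if n ∈ S.carrier then Finsupp.single (S.erase n) ((-1 : R) ^ S.above n) else 0

/-- The vacuum vector `|0⟩`. -/
def vac (R : Type*) [CommRing R] : Fock R := Finsupp.single Maya.vacuum 1

/-- `|-r⟩ = ψ*_{-r} ⋯ ψ*_{-2} ψ*_{-1} |0⟩`. -/
def shiftedVac (R : Type*) [CommRing R] : ℕ → Fock R
  | 0 => vac R
  | r + 1 => psiStar R (-((r : ℤ) + 1)) (shiftedVac R r)

/-- `v ↦ ⟨0|v⟩`, the coefficient of the vacuum vector. -/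
def vacCoeff (R : Type*) [CommRing R] : Fock R →ₗ[R] R := Finsupp.lapply Maya.vacuum

/-- The normally ordered product `:ψ_m ψ*_n:`, where `ψ_i` (`i < 0`) and `ψ*_i` (`i ≥ 0`) are moved
to the right. -/
def normalOrdered (R : Type*) [CommRing R] (m n : ℤ) : Module.End R (Fock R) :=
  if m < 0 ∧ n < 0 then -(psiStar R n * psi R m) else psi R m * psiStar R n

/-- The sum of a family of operators of which only finitely many are nonzero on each wedge. -/
def locSum {R : Type*} [CommRing R] {ι : Type*} (A : ι → Module.End R (Fock R)) :
    Module.End R (Fock R) :=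
  Finsupp.linearCombination R fun S : Maya => ∑ᶠ i, A i (Finsupp.single S 1)

/-- The current operator `a_m = ∑_{n ∈ ℤ} :ψ_n ψ*_{n+m}:`. -/
def current (R : Type*) [CommRing R] (m : ℤ) : Module.End R (Fock R) :=
  locSum fun n : ℤ => normalOrdered R n (n + m)

/-- The exponential `∑_{m ≥ 0} A^m / m!` of a locally nilpotent operator. -/
def locExp (k : Type*) [Field k] {R : Type*} [CommRing R] [Algebra k R]
    (A : Module.End R (Fock R)) : Module.End R (Fock R) :=
  locSum fun m : ℕ => algebraMap k R ((m.factorial : k)⁻¹) • A ^ m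

/-- `H(x) = ∑_{n > 0} (p_n(x) / n) a_n`. -/
def hamiltonian (k : Type*) [Field k] : Module.End (SymFun k) (Fock (SymFun k)) :=
  locSum fun n : ℕ =>
    (algebraMap k (SymFun k) (((n : k) + 1)⁻¹) * powerSum k (n + 1)) •
      current (SymFun k) ((n : ℤ) + 1)

/-- `θ = ∑_{n > 0} (-1)^{n-1} (βⁿ / n) a_n`. -/
def theta (k : Type*) [Field k] (β : k) : Module.End (SymFun k) (Fock (SymFun k)) :=
  locSum fun n : ℕ =>
    algebraMap k (SymFun k) ((-1) ^ n * β ^ (n + 1) * ((n : k) + 1)⁻¹) •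
      current (SymFun k) ((n : ℤ) + 1)

/-- `⟨0| e^{H(x)} (ψ_{μ_1 - 1} e^{-θ}) (ψ_{μ_2 - 2} e^{-θ}) ⋯ (ψ_{μ_r - r} e^{-θ}) |-r⟩ ∈ Λ`. -/
def dualGrothendieck (k : Type*) [Field k] (β : k) (μ : YoungDiagram) (r : ℕ) : SymFun k :=
  vacCoeff (SymFun k) (locExp k (hamiltonian k)
    ((List.ofFn fun i : Fin r =>
      psi (SymFun k) ((μ.rowLen i : ℤ) - ((i : ℤ) + 1)) * locExp k (-theta k β)).prod
      (shiftedVac (SymFun k) r)))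

end StableGrothendieck

end

noncomputable section
namespace StableGrothendieck

/-! ## The canonical anticommutation relations -/

namespace Maya

/-! Both families become determinants of the same shape, and the Hall pairing of two such
determinants is again a determinant, small enough to evaluate by hand. Indices `i`, `j` start at 0
here.

Fermionic side. With `ψ(z) = ∑ ψ_n z^n`, the commutator of `∑ t_{m-1} a_m` with `ψ(z)` is
multiplication by `T(z) = ∑ t_{m-1} z^m`, so moving the exponential of this operator past `ψ(z)`
multiplies `ψ(z)` by `exp T(z)` (`locExp_currentSum_psiSeries`), and the exponential fixes `|-r⟩`.
For `-θ` the factor is `1 / (1 + β z)`, for `H(x)` it is `∑ h_n z^n`. As `i` copies of `e^{-θ}`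
stand to the left of factor `i`, Wick's theorem (`vacCoeff_psiVec`) gives `g_μ = det [z^{μ_i - i +
j}] ((∑ h_n z^n) (1 + β z)^{-i})` (`dualGrothendieck_eq_det`).

Common form. The alternating map `jt` on `n`-tuples of polynomials sends the monomials `x^{μ_i + n -
1 - i}` to `s_μ`, and its restriction to `n` variables is `det (v_j(x_i))` over the Vandermonde
determinant (`restrict_jt_mul`). Hence `G_μ` modulo `M_{n+1}` is `jt` of `x^{μ_i + n - 1 - i} (1 + β
x)^i`, and `g_μ` is `jt` of the polynomial parts of `x^{μ_i + n - 1 - i} (1 + β / x)^{-i}`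
(`dualGrothendieck_eq_jt`). The Schur functions form a basis (`linearIndependent_schur`,
`span_schur`) and `M_{n+1}` is exactly the kernel of restriction to `n` variables; this makes the
extended pairing and `G_μ` well defined.

Duality. Since Schur functions are orthonormal, `hallInner_jt` turns `⟨G_μ, g_ν⟩` into the
determinant with entries `[z^{b_j}] z^{a_i} (1 + β z)^{i - j}`, where `a`, `b` are the shifted parts
of `μ`, `ν`. It is unitriangular if `a = b`, and otherwise has a zero block too large for a nonzero
determinant (`det_pairEntry`).

Uniqueness. `G_μ` is `s_μ` plus Schur functions of larger size, so a nonzero `f` pairs nontrivially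
with `G_μ` for `μ` of maximal size in the expansion of `f` (`eq_zero_of_hallPairing_eq_zero`). -/

@[simp] lemma mem_insert (S : Maya) (i j : ℤ) :
    i ∈ (S.insert j).carrier ↔ i = j ∨ i ∈ S.carrier := Iff.rfl

@[simp] lemma mem_erase (S : Maya) (i j : ℤ) :
    i ∈ (S.erase j).carrier ↔ i ≠ j ∧ i ∈ S.carrier := Iff.rfl

lemma finite_above (S : Maya) (j : ℤ) : {i | i ∈ S.carrier ∧ j < i}.Finite := by
  refine (S.finite_nonneg.union (Set.finite_Ioo j 0)).subset ?_
  rintro i ⟨h1, h2⟩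
  rcases lt_or_ge i 0 with h | h
  · exact Or.inr ⟨h2, h⟩
  · exact Or.inl ⟨h1, h⟩

lemma above_insert (S : Maya) {i j : ℤ} (hj : j ∉ S.carrier) :
    (S.insert j).above i = S.above i + if i < j then 1 else 0 := by
  unfold above
  split_ifs with h
  · rw [← Set.ncard_insert_of_notMem (a := j) (by simp [hj]) (S.finite_above i)]
    congr 1
    ext x
    simp only [mem_insert, Set.mem_insert_iff, Set.mem_ofPred_eq]
    constructor
    · rintro ⟨h1 | h1, h2⟩ <;> tauto
    · rintro (rfl | h1) <;> tauto
  · rw [add_zero]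
    congr 1
    ext x
    simp only [mem_insert, Set.mem_ofPred_eq]
    constructor
    · rintro ⟨rfl | h1, h2⟩ <;> tauto
    · tauto

lemma insert_erase (S : Maya) {j : ℤ} (hj : j ∈ S.carrier) : (S.erase j).insert j = S := by
  ext x
  simp only [mem_insert, mem_erase]
  by_cases h : x = j <;> simp_all

lemma erase_insert (S : Maya) {j : ℤ} (hj : j ∉ S.carrier) : (S.insert j).erase j = S := by
  ext x
  simp only [mem_insert, mem_erase]
  by_cases h : x = j <;> simp_all

lemma insert_comm (S : Maya) (i j : ℤ) : (S.insert i).insert j = (S.insert j).insert i := by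
  ext x
  simp only [mem_insert]
  tauto

lemma erase_insert_of_ne (S : Maya) {i j : ℤ} (h : i ≠ j) :
    (S.insert i).erase j = (S.erase j).insert i := by
  ext x
  simp only [mem_insert, mem_erase]
  by_cases h : x = i <;> simp_all

lemma above_erase (S : Maya) {i j : ℤ} (hj : j ∈ S.carrier) :
    S.above i = (S.erase j).above i + if i < j then 1 else 0 := by
  rw [← above_insert (S.erase j) (by simp), insert_erase S hj]

/-- The index set of `v_{-r-1} ∧ v_{-r-2} ∧ ⋯`. -/
def below (r : ℕ) : Maya where
  carrier := {i | i < -r}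
  finite_nonneg := by
    convert Set.finite_empty
    ext i; simp; omega
  finite_neg := (Set.finite_Ico (-r : ℤ) 0).subset fun i hi => by
    simp only [Set.mem_ofPred_eq, not_lt] at hi
    exact hi

@[simp] lemma mem_below (r : ℕ) (i : ℤ) : i ∈ (below r).carrier ↔ i < -r := Iff.rfl

lemma below_zero : below 0 = vacuum := by
  ext i; simp [below, vacuum]

/-- Every index set arises from some `below r` by adding indices. -/
lemma induction_insert {p : Maya → Prop} (base : ∀ r, p (below r))
    (step : ∀ S j, j ∉ S.carrier → p S → p (S.insert j)) (S : Maya) : p S := by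
  classical
  obtain ⟨m, hm⟩ := S.finite_neg.bddBelow
  have key : ∀ r : ℕ, (∀ i : ℤ, i < -r → i ∈ S.carrier) → p S := by
    intro r hr
    have hfin : {i | i ∈ S.carrier ∧ -(r : ℤ) ≤ i}.Finite :=
      (S.finite_above (-(r : ℤ) - 1)).subset fun i hi => ⟨hi.1, by have := hi.2; omega⟩
    obtain ⟨n, hn⟩ : ∃ n, {i | i ∈ S.carrier ∧ -(r : ℤ) ≤ i}.ncard = n := ⟨_, rfl⟩
    clear hm
    induction n generalizing S with
    | zero =>
      rw [Set.ncard_eq_zero hfin] at hn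
      have : S = below r := by
        ext i
        rw [mem_below]
        refine ⟨fun h => ?_, hr i⟩
        by_contra h'
        have : i ∈ {i | i ∈ S.carrier ∧ -(r : ℤ) ≤ i} := ⟨h, by omega⟩
        rw [hn] at this
        exact this
      rw [this]
      exact base r
    | succ n ih =>
      have hne : {i | i ∈ S.carrier ∧ -(r : ℤ) ≤ i}.Nonempty := by
        rw [Set.nonempty_iff_ne_empty]
        intro h
        rw [h] at hn
        simp at hn
      obtain ⟨j, hj, hj'⟩ := hne
      have hset : {i | i ∈ (S.erase j).carrier ∧ -(r : ℤ) ≤ i} =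
          {i | i ∈ S.carrier ∧ -(r : ℤ) ≤ i} \ {j} := by
        ext i
        simp only [mem_erase, Set.mem_ofPred_eq, Set.mem_sdiff, Set.mem_singleton_iff]
        tauto
      rw [← insert_erase S hj]
      refine step _ _ (by simp) (ih _ ?_ ?_ ?_)
      · intro i hi
        exact ⟨by omega, hr i hi⟩
      · rw [hset]
        exact hfin.sdiff
      · rw [hset, Set.ncard_sdiff_singleton_of_mem (by exact ⟨hj, hj'⟩), hn]
        rfl
  refine key m.natAbs fun i hi => ?_
  by_contra h
  have : m ≤ i := hm ⟨h, by omega⟩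
  omega

end Maya

variable {R : Type*} [CommRing R]

open Classical in
lemma psi_single (n : ℤ) (S : Maya) : psi R n (Finsupp.single S 1) =
    if n ∈ S.carrier then 0 else Finsupp.single (S.insert n) ((-1 : R) ^ S.above n) := by
  simp [psi]

open Classical in
lemma psiStar_single (n : ℤ) (S : Maya) : psiStar R n (Finsupp.single S 1) =
    if n ∈ S.carrier then Finsupp.single (S.erase n) ((-1 : R) ^ S.above n) else 0 := by
  simp [psiStar]

lemma psi_of_mem {n : ℤ} {S : Maya} (h : n ∈ S.carrier) :
    psi R n (Finsupp.single S 1) = 0 := by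
  simp [psi_single, h]

lemma psi_of_notMem {n : ℤ} {S : Maya} (h : n ∉ S.carrier) :
    psi R n (Finsupp.single S 1) = (-1 : R) ^ S.above n • Finsupp.single (S.insert n) 1 := by
  simp [psi_single, h]

lemma psiStar_of_mem {n : ℤ} {S : Maya} (h : n ∈ S.carrier) :
    psiStar R n (Finsupp.single S 1) = (-1 : R) ^ S.above n • Finsupp.single (S.erase n) 1 := by
  simp [psiStar_single, h]

lemma psiStar_of_notMem {n : ℤ} {S : Maya} (h : n ∉ S.carrier) :
    psiStar R n (Finsupp.single S 1) = 0 := by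
  simp [psiStar_single, h]

/-- Linear maps on the Fock space that agree on wedges are equal. -/
lemma fock_ext {M : Type*} [AddCommMonoid M] [Module R M] {A B : Fock R →ₗ[R] M}
    (h : ∀ S : Maya, A (Finsupp.single S 1) = B (Finsupp.single S 1)) (v : Fock R) : A v = B v := by
  rw [Finsupp.lhom_ext' (φ := A) (ψ := B) fun S => LinearMap.ext_ring (h S)]

lemma psi_psi_self (n : ℤ) (v : Fock R) : psi R n (psi R n v) = 0 := by
  refine fock_ext (A := psi R n ∘ₗ psi R n) (B := 0) (fun S => ?_) v
  by_cases h : n ∈ S.carrier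
  · simp [psi_of_mem h]
  · simp [-Finsupp.smul_single, psi_of_notMem h, psi_of_mem]

/-- Inserting `n` first raises the number of indices above `m` by one, while inserting `m` first
does not change the number above `n`; the two orders differ by exactly one sign. -/
lemma psi_psi_of_lt {m n : ℤ} (hmn : m < n) (v : Fock R) :
    psi R m (psi R n v) = -psi R n (psi R m v) := by
  refine fock_ext (A := psi R m ∘ₗ psi R n) (B := -(psi R n ∘ₗ psi R m)) (fun S => ?_) v
  by_cases hm : m ∈ S.carrier
  · by_cases hn : n ∈ S.carrier
    · simp [psi_of_mem hn, psi_of_mem hm]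
    · simp [-Finsupp.smul_single, psi_of_notMem hn, psi_of_mem hm,
        psi_of_mem (S := S.insert n) (n := m) (by simp [hm])]
  · by_cases hn : n ∈ S.carrier
    · simp [-Finsupp.smul_single, psi_of_mem hn, psi_of_notMem hm,
        psi_of_mem (S := S.insert m) (n := n) (by simp [hn])]
    · simp [-Finsupp.smul_single, psi_of_notMem hn, psi_of_notMem hm,
        psi_of_notMem (S := S.insert m) (n := n) (by simp [hn, hmn.ne']),
        psi_of_notMem (S := S.insert n) (n := m) (by simp [hm, hmn.ne]),
        Maya.above_insert S hm, Maya.above_insert S hn, hmn, hmn.not_gt, Maya.insert_comm S m n,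
        pow_succ, smul_smul, mul_comm]

lemma psi_psi (m n : ℤ) (v : Fock R) : psi R m (psi R n v) = -psi R n (psi R m v) := by
  rcases lt_trichotomy m n with h | rfl | h
  · exact psi_psi_of_lt h v
  · simp [psi_psi_self]
  · rw [psi_psi_of_lt h, neg_neg]

lemma psiStar_psi_self (n : ℤ) (v : Fock R) :
    psiStar R n (psi R n v) = v - psi R n (psiStar R n v) := by
  refine fock_ext (A := psiStar R n ∘ₗ psi R n) (B := LinearMap.id - psi R n ∘ₗ psiStar R n)
    (fun S => ?_) v
  by_cases h : n ∈ S.carrier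
  · have := Maya.above_erase S (i := n) h
    simp only [lt_irrefl, if_false, add_zero] at this
    simp [-Finsupp.smul_single, psi_of_mem h, psiStar_of_mem h,
      psi_of_notMem (S := S.erase n) (n := n) (by simp),
      Maya.insert_erase S h, this, smul_smul, ← pow_add, ← two_mul]
  · simp [-Finsupp.smul_single, psi_of_notMem h, psiStar_of_notMem h,
      psiStar_of_mem (S := S.insert n) (n := n) (by simp),
      Maya.erase_insert S h, Maya.above_insert S h, smul_smul, ← pow_add, ← two_mul]

lemma psiStar_psi_of_ne {m n : ℤ} (h : m ≠ n) (v : Fock R) :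
    psiStar R m (psi R n v) = -psi R n (psiStar R m v) := by
  refine fock_ext (A := psiStar R m ∘ₗ psi R n) (B := -(psi R n ∘ₗ psiStar R m)) (fun S => ?_) v
  by_cases hm : m ∈ S.carrier
  · by_cases hn : n ∈ S.carrier
    · simp [-Finsupp.smul_single, psi_of_mem hn, psiStar_of_mem hm,
        psi_of_mem (S := S.erase m) (n := n) (by simp [hn, h.symm])]
    · have e1 := Maya.above_erase S (i := n) hm
      have e2 := Maya.above_insert S (i := m) hn
      simp only [LinearMap.coe_comp, Function.comp_apply, psi_of_notMem hn, map_smul,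
        psiStar_of_mem (S := S.insert n) (n := m) (by simp [hm]),
        psiStar_of_mem hm, psi_of_notMem (S := S.erase m) (n := n) (by simp [hn]),
        Maya.erase_insert_of_ne S h.symm, LinearMap.neg_apply, smul_smul, ← neg_smul]
      congr 1
      rw [e1, e2]
      rcases lt_or_gt_of_ne h with h' | h'
      · simp only [h', h'.not_gt, if_true, if_false]; ring
      · simp only [h', h'.not_gt, if_true, if_false]; ring
  · by_cases hn : n ∈ S.carrier
    · simp [psi_of_mem hn, psiStar_of_notMem hm]
    · simp [-Finsupp.smul_single, psi_of_notMem hn, psiStar_of_notMem hm,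
        psiStar_of_notMem (S := S.insert n) (n := m) (by simp [hm, h])]

/-- Off the diagonal the two operators anticommute, so the reordering is compensated by its sign.
Only currents `a_m` with `m > 0` occur, hence normal ordering plays no further role. -/
lemma normalOrdered_apply_of_ne {m n : ℤ} (h : m ≠ n) (v : Fock R) :
    normalOrdered R m n v = psi R m (psiStar R n v) := by
  unfold normalOrdered
  split_ifs
  · rw [LinearMap.neg_apply, Module.End.mul_apply, psiStar_psi_of_ne h.symm, neg_neg]
  · rfl

/-- The commutator of `:ψ_j ψ*_{j+m}:` with `ψ_n`. -/
lemma normalOrdered_psi {m : ℤ} (hm : m ≠ 0) (j n : ℤ) (v : Fock R) :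
    normalOrdered R j (j + m) (psi R n v) = psi R n (normalOrdered R j (j + m) v) +
      if j = n - m then psi R (n - m) v else 0 := by
  have hne : j ≠ j + m := by omega
  rw [normalOrdered_apply_of_ne hne, normalOrdered_apply_of_ne hne]
  split_ifs with h
  · have h' : j + m = n := by omega
    rw [h', psiStar_psi_self, map_sub, psi_psi, h]
    abel
  · rw [psiStar_psi_of_ne (by omega), map_neg, psi_psi, neg_neg, add_zero]

/-- Each contraction removes the largest remaining index, so no signs appear. -/
lemma shiftedVac_eq (r : ℕ) : shiftedVac R r = Finsupp.single (Maya.below r) 1 := by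
  induction r with
  | zero => rw [Maya.below_zero]; rfl
  | succ r ih =>
    have h1 : (Maya.below r).above (-((r : ℤ) + 1)) = 0 := by
      unfold Maya.above
      convert Set.ncard_empty ℤ
      ext i; simp; omega
    have h2 : (Maya.below r).erase (-((r : ℤ) + 1)) = Maya.below (r + 1) := by
      ext i; simp; omega
    rw [shiftedVac, ih, psiStar_of_mem (by simp), h1, h2, pow_zero, one_smul]

/-- The Fock space is generated by the vectors `|-r⟩` under the operators `ψ_n`. -/
lemma fock_induction {p : Fock R → Prop} (zero : p 0)
    (add : ∀ v w, p v → p w → p (v + w)) (smul : ∀ (c : R) v, p v → p (c • v))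
    (vac : ∀ r, p (shiftedVac R r)) (psi : ∀ n v, p v → p (psi R n v)) (v : Fock R) : p v := by
  have h : ∀ S : Maya, p (Finsupp.single S 1) := by
    refine Maya.induction_insert (fun r => ?_) fun S j hj h => ?_
    · rw [← shiftedVac_eq]
      exact vac r
    · have := smul ((-1) ^ S.above j) _ (psi j _ h)
      rwa [psi_of_notMem hj, smul_smul, ← pow_add, ← two_mul, pow_mul, neg_one_sq, one_pow,
        one_smul] at this
  induction v using Finsupp.induction_linear with
  | zero => exact zero
  | add f g hf hg => exact add f g hf hg
  | single S c =>
    have := smul c _ (h S)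
    rwa [Finsupp.smul_single, smul_eq_mul, mul_one] at this

end StableGrothendieck
end

noncomputable section
namespace StableGrothendieck

/-! ## Currents and their exponentials -/

variable {R : Type*} [CommRing R]

/-! ### Locally finite sums of operators -/

section LocSum

variable {ι : Type*}

/-- A family of operators on the Fock space of which only finitely many do not kill a given
vector. -/
def LocFinite (A : ι → Module.End R (Fock R)) : Prop :=
  ∀ v, (Function.support fun i => A i v).Finite

lemma LocFinite.of_induction {A : ι → Module.End R (Fock R)}
    (vac : ∀ r, (Function.support fun i => A i (shiftedVac R r)).Finite)
    (step : ∀ n v, (Function.support fun i => A i v).Finite →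
      (Function.support fun i => A i (psi R n v)).Finite) : LocFinite A := by
  intro v
  refine fock_induction (p := fun v => (Function.support fun i => A i v).Finite)
    ?_ ?_ ?_ vac step v
  · simp
  · intro v w hv hw
    refine (hv.union hw).subset fun i hi => ?_
    by_contra h
    simp only [Set.mem_union, Function.mem_support, not_or, not_not] at h
    exact hi (by simp [h.1, h.2])
  · intro c v hv
    refine hv.subset fun i hi h => hi ?_
    simp only at h
    simp [h]

lemma locSum_apply {A : ι → Module.End R (Fock R)} (hA : LocFinite A) (v : Fock R) :
    locSum A v = ∑ᶠ i, A i v := by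
  induction v using Finsupp.induction_linear with
  | zero => simp
  | add f g hf hg =>
    simp only [map_add, hf, hg]
    rw [finsum_add_distrib (hA f) (hA g)]
  | single S c =>
    have h : ∀ B : Module.End R (Fock R), B (Finsupp.single S c) = c • B (Finsupp.single S 1) := by
      intro B
      rw [← map_smul, Finsupp.smul_single, smul_eq_mul, mul_one]
    simp only [h (A _)]
    rw [← smul_finsum' c (hA _)]
    simp [locSum]

lemma locSum_apply_eq_sum {A : ι → Module.End R (Fock R)} (hA : LocFinite A) (v : Fock R)
    (s : Finset ι) (hs : ∀ i, i ∉ s → A i v = 0) : locSum A v = ∑ i ∈ s, A i v := by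
  rw [locSum_apply hA]
  refine finsum_eq_sum_of_support_subset _ fun i hi => ?_
  by_contra h
  exact hi (hs i h)

lemma locSum_apply_eq_zero {A : ι → Module.End R (Fock R)} (hA : LocFinite A) (v : Fock R)
    (h : ∀ i, A i v = 0) : locSum A v = 0 := by
  rw [locSum_apply_eq_sum hA v ∅ fun i _ => h i, Finset.sum_empty]

end LocSum

/-- If `j + m` is occupied in `|-r⟩`, then so is the smaller `j`, and it stays occupied after `j +
m` is removed; if not, `ψ*_{j+m}` already kills the vector. -/
lemma normalOrdered_shiftedVac {m : ℤ} (hm : 0 < m) (j : ℤ) (r : ℕ) :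
    normalOrdered R j (j + m) (shiftedVac R r) = 0 := by
  rw [normalOrdered_apply_of_ne (by omega), shiftedVac_eq]
  by_cases h : j + m ∈ (Maya.below r).carrier
  · rw [psiStar_of_mem h, map_smul, psi_of_mem, smul_zero]
    rw [Maya.mem_below] at h
    simp only [Maya.mem_erase, Maya.mem_below]
    omega
  · rw [psiStar_of_notMem h, map_zero]

lemma locFinite_current {m : ℤ} (hm : 0 < m) :
    LocFinite fun j : ℤ => normalOrdered R j (j + m) := by
  refine LocFinite.of_induction (fun r => ?_) fun n v hv => ?_
  · simp [normalOrdered_shiftedVac hm]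
  · refine (hv.union (Set.finite_singleton (n - m))).subset fun j hj => ?_
    by_contra h
    simp only [Set.mem_union, Function.mem_support, not_or, not_not, Set.mem_singleton_iff] at h
    refine hj ?_
    simp only
    rw [normalOrdered_psi hm.ne', h.1, if_neg h.2, map_zero, zero_add]

lemma current_shiftedVac {m : ℤ} (hm : 0 < m) (r : ℕ) : current R m (shiftedVac R r) = 0 :=
  locSum_apply_eq_zero (locFinite_current hm) _ fun j => normalOrdered_shiftedVac hm j r

/-- Only the summand with `j = n - m` fails to commute with `ψ_n`. -/
lemma current_psi {m : ℤ} (hm : 0 < m) (n : ℤ) (v : Fock R) :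
    current R m (psi R n v) = psi R n (current R m v) + psi R (n - m) v := by
  classical
  have hA := locFinite_current (R := R) hm
  set s := insert (n - m) (hA v).toFinset with hs
  have h0 : ∀ j ∉ s, normalOrdered R j (j + m) v = 0 := by
    intro j hj
    by_contra h
    exact hj (Finset.mem_insert_of_mem ((hA v).mem_toFinset.2 h))
  unfold current
  rw [locSum_apply_eq_sum hA v s h0, locSum_apply_eq_sum hA (psi R n v) s]
  · simp only [normalOrdered_psi hm.ne', Finset.sum_add_distrib, map_sum]
    rw [Finset.sum_ite_eq' s (n - m), if_pos (Finset.mem_insert_self _ _)]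
  · intro j hj
    rw [normalOrdered_psi hm.ne', h0 j hj, if_neg, map_zero, zero_add]
    rintro rfl
    exact hj (Finset.mem_insert_self _ _)

open Filter in
-- All sufficiently negative indices are occupied in every wedge of `v`. This is what allows a power
-- series in `z` to act on `ψ(z)`.
lemma eventually_psi_eq_zero (n : ℤ) (v : Fock R) :
    ∀ᶠ d : ℕ in atTop, psi R (n - d) v = 0 := by
  refine fock_induction (p := fun v => ∀ᶠ d : ℕ in atTop, psi R (n - d) v = 0) ?_ ?_ ?_ ?_ ?_ v
  · simp
  · intro v w hv hw
    filter_upwards [hv, hw] with d h1 h2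
    simp [h1, h2]
  · intro c v hv
    filter_upwards [hv] with d h1
    simp [h1]
  · intro r
    filter_upwards [eventually_ge_atTop ((n + r).toNat + 1)] with d hd
    rw [shiftedVac_eq, psi_of_mem]
    rw [Maya.mem_below]
    omega
  · intro m v hv
    filter_upwards [hv] with d h1
    rw [psi_psi, h1, map_zero, neg_zero]

lemma exists_psi_eq_zero (n : ℤ) (v : Fock R) : ∃ D : ℕ, ∀ d ≥ D, psi R (n - d) v = 0 :=
  Filter.eventually_atTop.1 (eventually_psi_eq_zero n v)

/-! ### Power series acting on the fermion field, and powers of currents -/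

section PsiSeries

open PowerSeries

lemma locFinite_psi (f : R⟦X⟧) (n : ℤ) :
    LocFinite fun d : ℕ => coeff d f • psi R (n - d) := by
  intro v
  obtain ⟨D, hD⟩ := exists_psi_eq_zero n v
  refine (Set.finite_lt_nat D).subset fun d hd => ?_
  by_contra h
  refine hd ?_
  simp [hD d (not_lt.1 h)]

/-- The coefficient of `z^n` in `f(z) ψ(z)`, where `ψ(z) = ∑ ψ_n z^n`. -/
def psiSeries (f : R⟦X⟧) (n : ℤ) : Module.End R (Fock R) :=
  locSum fun d : ℕ => coeff d f • psi R (n - d)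

lemma psiSeries_apply (f : R⟦X⟧) {n : ℤ} {v : Fock R} {D : ℕ}
    (hD : ∀ d ≥ D, psi R (n - d) v = 0) :
    psiSeries f n v = ∑ d ∈ Finset.range D, coeff d f • psi R (n - d) v :=
  locSum_apply_eq_sum (locFinite_psi f n) v _ fun d hd => by
    simp [hD d (by simpa using hd)]

lemma psiSeries_add (f g : R⟦X⟧) (n : ℤ) (v : Fock R) :
    psiSeries (f + g) n v = psiSeries f n v + psiSeries g n v := by
  obtain ⟨D, hD⟩ := exists_psi_eq_zero n v
  simp only [psiSeries_apply _ hD, map_add, add_smul, Finset.sum_add_distrib]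

lemma psiSeries_smul (c : R) (f : R⟦X⟧) (n : ℤ) (v : Fock R) :
    psiSeries (c • f) n v = c • psiSeries f n v := by
  obtain ⟨D, hD⟩ := exists_psi_eq_zero n v
  simp only [psiSeries_apply _ hD, Finset.smul_sum, smul_smul, PowerSeries.coeff_smul, smul_eq_mul]

/-- `psiSeries` as a bilinear map. -/
def psiSeriesLin (n : ℤ) : R⟦X⟧ →ₗ[R] Fock R →ₗ[R] Fock R where
  toFun f := psiSeries f n
  map_add' f g := LinearMap.ext (psiSeries_add f g n)
  map_smul' c f := LinearMap.ext (psiSeries_smul c f n)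

lemma psiSeriesLin_apply (n : ℤ) (f : R⟦X⟧) (v : Fock R) :
    psiSeriesLin n f v = psiSeries f n v := rfl

lemma psiSeries_one (n : ℤ) (v : Fock R) : psiSeries 1 n v = psi R n v := by
  obtain ⟨D, hD⟩ := exists_psi_eq_zero n v
  rw [psiSeries_apply _ (D := D + 1) fun d hd => hD d (by omega), Finset.sum_range_succ']
  simp [PowerSeries.coeff_one]

lemma psiSeries_X_mul (f : R⟦X⟧) (n : ℤ) (v : Fock R) :
    psiSeries (X * f) n v = psiSeries f (n - 1) v := by
  obtain ⟨D, hD⟩ := exists_psi_eq_zero n v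
  rw [psiSeries_apply _ (D := D + 1) fun d hd => hD d (by omega), Finset.sum_range_succ',
    psiSeries_apply (n := n - 1) (D := D)]
  · simp [PowerSeries.coeff_succ_X_mul, sub_sub, add_comm]
  · intro d hd
    have := hD (d + 1) (by omega)
    push_cast at this
    rwa [sub_sub, add_comm]

lemma psiSeries_X_pow_mul (d : ℕ) (f : R⟦X⟧) (n : ℤ) (v : Fock R) :
    psiSeries (X ^ d * f) n v = psiSeries f (n - d) v := by
  induction d generalizing n with
  | zero => simp
  | succ d ih =>
    rw [pow_succ', mul_assoc, psiSeries_X_mul, ih]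
    push_cast
    rw [sub_sub, add_comm]

lemma psiSeries_eq_zero {f : R⟦X⟧} {n : ℤ} {v : Fock R} {D : ℕ}
    (hD : ∀ d ≥ D, psi R (n - d) v = 0) (hf : X ^ D ∣ f) : psiSeries f n v = 0 := by
  rw [psiSeries_apply _ hD]
  refine Finset.sum_eq_zero fun d hd => ?_
  rw [X_pow_dvd_iff.1 hf d (Finset.mem_range.1 hd), zero_smul]

/-- On a fixed vector only finitely many coefficients matter, so a series may be replaced by a
truncation. -/
lemma psiSeries_congr {f g : R⟦X⟧} {n : ℤ} {v : Fock R} {D : ℕ}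
    (hD : ∀ d ≥ D, psi R (n - d) v = 0) (h : X ^ D ∣ f - g) : psiSeries f n v = psiSeries g n v := by
  rw [← sub_add_cancel f g, psiSeries_add, psiSeries_eq_zero hD h, zero_add]

/-- The operator `∑_{m > 0} t_{m-1} a_m`. -/
def currentSum (t : ℕ → R) : Module.End R (Fock R) :=
  locSum fun m : ℕ => t m • current R ((m : ℤ) + 1)

lemma locFinite_currentSum (t : ℕ → R) :
    LocFinite fun m : ℕ => t m • current R ((m : ℤ) + 1) := by
  refine LocFinite.of_induction (fun r => ?_) fun n v hv => ?_
  · simp [current_shiftedVac (R := R) (m := _ + 1) (Int.lt_add_one_of_le (Int.natCast_nonneg _))]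
  · obtain ⟨D, hD⟩ := exists_psi_eq_zero n v
    refine (hv.union (Set.finite_lt_nat D)).subset fun m hm => ?_
    by_contra h
    simp only [Set.mem_union, Function.mem_support, not_or, not_not, Set.mem_ofPred_eq,
      not_lt] at h
    refine hm ?_
    have h1 := hD (m + 1) (by omega)
    push_cast at h1
    simp only [LinearMap.smul_apply] at h ⊢
    rw [current_psi (by omega), smul_add, ← map_smul, h.1, map_zero, zero_add, h1, smul_zero]

lemma currentSum_shiftedVac (t : ℕ → R) (r : ℕ) : currentSum t (shiftedVac R r) = 0 :=
  locSum_apply_eq_zero (locFinite_currentSum t) _ fun m => by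
    rw [LinearMap.smul_apply, current_shiftedVac (by omega), smul_zero]

/-- Summing the commutators `[a_m, ψ_n] = ψ_{n-m}` over `m` shows that the commutator with `ψ(z)` is
multiplication by the scalar series `X * mk t`. -/
lemma currentSum_psi (t : ℕ → R) (n : ℤ) (v : Fock R) :
    currentSum t (psi R n v) = psi R n (currentSum t v) + psiSeries (X * mk t) n v := by
  classical
  have hA := locFinite_currentSum t
  obtain ⟨D, hD⟩ := exists_psi_eq_zero (n - 1) v
  set s := Finset.range D ∪ (hA v).toFinset ∪ (hA (psi R n v)).toFinset with hs
  have h0 : ∀ j ∉ s, (t j • current R ((j : ℤ) + 1)) v = 0 := by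
    intro j hj
    by_contra h
    refine hj ?_
    simp only [hs, Finset.mem_union, Set.Finite.mem_toFinset, Function.mem_support]
    tauto
  have h1 : ∀ j ∉ s, (t j • current R ((j : ℤ) + 1)) (psi R n v) = 0 := by
    intro j hj
    by_contra h
    refine hj ?_
    simp only [hs, Finset.mem_union, Set.Finite.mem_toFinset, Function.mem_support]
    tauto
  rw [psiSeries_X_mul, psiSeries]
  unfold currentSum
  rw [locSum_apply_eq_sum hA v s h0, locSum_apply_eq_sum hA (psi R n v) s h1,
    locSum_apply_eq_sum (locFinite_psi _ _) v s, map_sum, ← Finset.sum_add_distrib]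
  · refine Finset.sum_congr rfl fun m _ => ?_
    simp only [LinearMap.smul_apply]
    rw [current_psi (by omega), smul_add, map_smul, coeff_mk, sub_sub, add_comm (1 : ℤ)]
  · intro d hd
    have : D ≤ d := by
      by_contra h
      exact hd (by simp only [hs, Finset.mem_union, Finset.mem_range]; omega)
    simp [hD d this]

lemma currentSum_psiSeries (t : ℕ → R) (f : R⟦X⟧) (n : ℤ) (v : Fock R) :
    currentSum t (psiSeries f n v) =
      psiSeries (X * mk t * f) n v + psiSeries f n (currentSum t v) := by
  obtain ⟨D, hD1, hD2⟩ : ∃ D : ℕ, (∀ d ≥ D, psi R (n - d) v = 0) ∧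
      ∀ d ≥ D, psi R (n - d) (currentSum t v) = 0 := by
    obtain ⟨D, hD⟩ := exists_psi_eq_zero n v
    obtain ⟨D', hD'⟩ := exists_psi_eq_zero n (currentSum t v)
    exact ⟨max D D', fun d hd => hD d (le_of_max_le_left hd), fun d hd => hD' d (le_of_max_le_right hd)⟩
  have hf : X ^ D ∣ f - ∑ d ∈ Finset.range D, coeff d f • (X : R⟦X⟧) ^ d := by
    rw [X_pow_dvd_iff]
    intro m hm
    simp [coeff_X_pow, hm]
  have h1 : psiSeries (X * mk t * f) n v =
      psiSeries (X * mk t * ∑ d ∈ Finset.range D, coeff d f • (X : R⟦X⟧) ^ d) n v := by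
    refine psiSeries_congr hD1 ?_
    rw [← mul_sub]
    exact hf.mul_left _
  rw [h1, psiSeries_apply f hD1, psiSeries_apply f hD2, map_sum, Finset.mul_sum,
    ← psiSeriesLin_apply, map_sum, LinearMap.sum_apply, ← Finset.sum_add_distrib]
  refine Finset.sum_congr rfl fun d _ => ?_
  rw [map_smul, currentSum_psi, mul_smul_comm, map_smul, LinearMap.smul_apply, psiSeriesLin_apply,
    mul_comm _ ((X : R⟦X⟧) ^ d), psiSeries_X_pow_mul, smul_add, add_comm]

-- The action `Ψ` of series on vectors intertwines `A` with `P + Q` on the tensor product, where `P`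
-- multiplies the series by `T` and `Q` applies `A` to the vector. These commute, so the binomial
-- theorem applies.
open TensorProduct in
lemma currentSum_pow_psiSeries (t : ℕ → R) (f : R⟦X⟧) (n : ℤ) (v : Fock R) (m : ℕ) :
    (currentSum t ^ m) (psiSeries f n v) = ∑ p ∈ Finset.HasAntidiagonal.antidiagonal m,
      m.choose p.1 • psiSeries ((X * mk t) ^ p.1 * f) n ((currentSum t ^ p.2) v) := by
  set T : R⟦X⟧ := X * mk t
  set A := currentSum t
  let Ψ : R⟦X⟧ ⊗[R] Fock R →ₗ[R] Fock R := TensorProduct.lift (psiSeriesLin n)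
  let P : Module.End R (R⟦X⟧ ⊗[R] Fock R) := (LinearMap.mulLeft R T).rTensor (Fock R)
  let Q : Module.End R (R⟦X⟧ ⊗[R] Fock R) := A.lTensor R⟦X⟧
  have hPQ : Commute P Q := by
    refine TensorProduct.ext' fun g w => ?_
    simp [P, Q]
  have h1 : A ∘ₗ Ψ = Ψ ∘ₗ (P + Q) := by
    refine TensorProduct.ext' fun g w => ?_
    simp [Ψ, P, Q, psiSeriesLin_apply, A, T, currentSum_psiSeries, mul_assoc]
  have h2 : ∀ x, (A ^ m) (Ψ x) = Ψ (((P + Q) ^ m) x) := by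
    induction m with
    | zero => simp
    | succ m ih =>
      intro x
      rw [pow_succ', pow_succ', Module.End.mul_apply, Module.End.mul_apply, ih]
      exact LinearMap.congr_fun h1 _
  have hP : ∀ i g w, (P ^ i) (g ⊗ₜ w) = (T ^ i * g) ⊗ₜ w := by
    intro i g w
    induction i with
    | zero => simp
    | succ i _ => simp [pow_succ', P, mul_assoc]
  have hQ : ∀ i g w, (Q ^ i) (g ⊗ₜ w) = g ⊗ₜ ((A ^ i) w) := by
    intro i g w
    induction i with
    | zero => simp
    | succ i _ => simp [pow_succ', Q]
  have h3 := h2 (f ⊗ₜ v)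
  rw [hPQ.add_pow'] at h3
  simp only [LinearMap.sum_apply, map_sum, LinearMap.smul_apply, Module.End.mul_apply, hQ, hP,
    map_nsmul] at h3
  exact h3

/-- Only finitely many of the vectors `A^j v` are nonzero, so one bound serves for all `j`. -/
lemma exists_psi_currentSum_pow_eq_zero (t : ℕ → R) (n : ℤ) (v : Fock R) {M : ℕ}
    (hM : ∀ m ≥ M, (currentSum t ^ m) v = 0) : ∃ D : ℕ, ∀ d ≥ D, ∀ j,
      psi R (n - d) ((currentSum t ^ j) v) = 0 := by
  obtain ⟨D, hD⟩ := Filter.eventually_atTop.1 ((Filter.eventually_all_finset (Finset.range M)).2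
    fun j _ => eventually_psi_eq_zero n ((currentSum t ^ j) v))
  refine ⟨D, fun d hd j => ?_⟩
  by_cases hj : j < M
  · exact hD d hd j (Finset.mem_range.2 hj)
  · rw [hM j (not_lt.1 hj), map_zero]

lemma X_pow_dvd_pow_mul (g f : R⟦X⟧) {D i : ℕ} (h : D ≤ i) : X ^ D ∣ (X * g) ^ i * f := by
  rw [mul_pow]
  exact ((pow_dvd_pow X h).mul_right _).mul_right _

/-- Local nilpotency passes from `v` to `ψ_n v`: in the binomial expansion of a power `m ≥ M + D`,
either the power of `A` kills `v`, or the power of `T` is divisible by `X ^ D` and annihilates what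
remains. -/
lemma exists_currentSum_pow_eq_zero (t : ℕ → R) (v : Fock R) :
    ∃ M : ℕ, ∀ m ≥ M, (currentSum t ^ m) v = 0 := by
  refine fock_induction (p := fun v => ∃ M : ℕ, ∀ m ≥ M, (currentSum t ^ m) v = 0) ?_ ?_ ?_ ?_ ?_ v
  · exact ⟨0, by simp⟩
  · rintro v w ⟨M, hM⟩ ⟨N, hN⟩
    exact ⟨max M N, fun m hm => by
      rw [map_add, hM m (le_of_max_le_left hm), hN m (le_of_max_le_right hm), add_zero]⟩
  · rintro c v ⟨M, hM⟩
    exact ⟨M, fun m hm => by rw [map_smul, hM m hm, smul_zero]⟩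
  · refine fun r => ⟨1, fun m hm => ?_⟩
    obtain ⟨m, rfl⟩ := Nat.exists_eq_add_of_le' hm
    rw [pow_succ, Module.End.mul_apply, currentSum_shiftedVac, map_zero]
  · rintro n v ⟨M, hM⟩
    obtain ⟨D, hD⟩ := exists_psi_currentSum_pow_eq_zero t n v hM
    refine ⟨M + D, fun m hm => ?_⟩
    rw [← psiSeries_one, currentSum_pow_psiSeries]
    refine Finset.sum_eq_zero fun p hp => ?_
    rw [Finset.HasAntidiagonal.mem_antidiagonal] at hp
    rcases le_or_gt M p.2 with h | h
    · rw [hM _ h, map_zero, smul_zero]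
    · rw [psiSeries_eq_zero (fun d hd => hD d hd _) (X_pow_dvd_pow_mul _ _ (by omega)), smul_zero]

end PsiSeries

end StableGrothendieck
end

noncomputable section
namespace StableGrothendieck

/-! ## Vertex operators: conjugation of `ψ` by exponentials of currents -/

section Exponential

open PowerSeries

variable (k : Type*) [Field k] {R : Type*} [CommRing R] [Algebra k R]

lemma locFinite_pow_currentSum (t : ℕ → R) :
    LocFinite fun m : ℕ => algebraMap k R ((m.factorial : k)⁻¹) • currentSum t ^ m := by
  intro v
  obtain ⟨M, hM⟩ := exists_currentSum_pow_eq_zero t v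
  refine (Set.finite_lt_nat M).subset fun m hm => ?_
  by_contra h
  refine hm ?_
  simp [hM m (not_lt.1 h)]

lemma locExp_currentSum_apply {t : ℕ → R} {v : Fock R} {M : ℕ}
    (hM : ∀ m ≥ M, (currentSum t ^ m) v = 0) : locExp k (currentSum t) v =
      ∑ m ∈ Finset.range M, algebraMap k R ((m.factorial : k)⁻¹) • (currentSum t ^ m) v :=
  locSum_apply_eq_sum (locFinite_pow_currentSum k t) v _ fun m hm => by
    simp [hM m (by simpa using hm)]

lemma locExp_currentSum_shiftedVac (t : ℕ → R) (r : ℕ) :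
    locExp k (currentSum t) (shiftedVac R r) = shiftedVac R r := by
  rw [locExp_currentSum_apply k (M := 1)]
  · simp
  · intro m hm
    obtain ⟨m, rfl⟩ := Nat.exists_eq_add_of_le' hm
    rw [pow_succ, Module.End.mul_apply, currentSum_shiftedVac, map_zero]

lemma factorial_inv_mul_choose [CharZero k] (i j : ℕ) :
    (((i + j).factorial : k)⁻¹) * ((i + j).choose i : k) =
      ((i.factorial : k)⁻¹) * ((j.factorial : k)⁻¹) := by
  have h := Nat.choose_symm_add (a := i) (b := j) ▸ Nat.add_choose_mul_factorial_mul_factorial i j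
  have h' : (((i + j).choose i : ℕ) : k) * (i.factorial : k) * (j.factorial : k) =
      ((i + j).factorial : k) := by exact_mod_cast h
  have h1 : (i.factorial : k) ≠ 0 := by exact_mod_cast i.factorial_ne_zero
  have h2 : (j.factorial : k) ≠ 0 := by exact_mod_cast j.factorial_ne_zero
  have h3 : ((i + j).factorial : k) ≠ 0 := by exact_mod_cast (i + j).factorial_ne_zero
  field_simp
  rw [← h']

/-- The solution of `F' = T' F`, `F(0) = 1`, agrees with the partial sums of `exp T`. -/
lemma X_pow_dvd_sub_exp [CharZero k] {T F : R⟦X⟧} (hT : constantCoeff T = 0)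
    (hF : constantCoeff F = 1) (hFT : derivative R F = derivative R T * F) (D : ℕ) :
    X ^ D ∣ F - ∑ i ∈ Finset.range D, algebraMap k R ((i.factorial : k)⁻¹) • T ^ i := by
  induction D with
  | zero => simp
  | succ D ih =>
    set E : ℕ → R⟦X⟧ := fun D => ∑ i ∈ Finset.range D, algebraMap k R ((i.factorial : k)⁻¹) • T ^ i
    -- Differentiation shortens the truncated exponential by one term, so each step of the induction
    -- gains one order in `X`. Characteristic zero is needed to integrate back.
    have hE : derivative R (E (D + 1)) = derivative R T * E D := by
      simp only [E, Finset.mul_sum]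
      rw [Finset.sum_range_succ', map_add, map_sum, pow_zero, Derivation.map_smul, Derivation.map_one_eq_zero, smul_zero, add_zero]
      refine Finset.sum_congr rfl fun i _ => ?_
      rw [Derivation.map_smul, Derivation.leibniz_pow, Nat.add_sub_cancel, smul_eq_mul, mul_comm (T ^ i),
        mul_smul_comm, ← Nat.cast_smul_eq_nsmul R, smul_smul]
      congr 1
      have h0 : (i.factorial : k) ≠ 0 := by exact_mod_cast i.factorial_ne_zero
      have h1 : ((i : k) + 1) ≠ 0 := by exact_mod_cast i.succ_ne_zero
      rw [← map_natCast (algebraMap k R), ← map_mul]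
      congr 1
      rw [Nat.factorial_succ]
      push_cast
      field_simp
    have hg : derivative R (F - E (D + 1)) = derivative R T * (F - E D) := by
      rw [map_sub, hFT, hE, mul_sub]
    have hdvd : X ^ D ∣ derivative R (F - E (D + 1)) := hg ▸ ih.mul_left _
    rw [X_pow_dvd_iff] at hdvd ⊢
    intro m hm
    rcases m with _ | m
    · rw [coeff_zero_eq_constantCoeff_apply, map_sub, hF, map_sum, Finset.sum_range_succ']
      simp [hT]
    · have h := hdvd m (by omega)
      rw [PowerSeries.coeff_derivative] at h
      have h1 : ((m : k) + 1) ≠ 0 := by exact_mod_cast m.succ_ne_zero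
      have h2 : algebraMap k R ((m : k) + 1) = (m : R) + 1 := by simp
      rw [← h2] at h
      have h3 := congrArg (· * algebraMap k R ((m : k) + 1)⁻¹) h
      simp only [mul_assoc, ← map_mul, mul_inv_cancel₀ h1] at h3
      rwa [map_one, mul_one, zero_mul] at h3

/-- The vertex operator relation `e^A ψ(z) e^{-A} = e^{T(z)} ψ(z)`: the factor `1 / m!` splits each
binomial coefficient into `1 / i!` and `1 / j!`, and the double sum becomes a product of
exponentials. The series `e^T` is given by its differential equation, which is easy to verify for `∑
h_n z^n` and `1 / (1 + β z)`. -/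
lemma locExp_currentSum_psiSeries [CharZero k] {t : ℕ → R} {F : R⟦X⟧}
    (hF : constantCoeff F = 1) (hFT : derivative R F = derivative R (X * mk t) * F)
    (f : R⟦X⟧) (n : ℤ) (v : Fock R) :
    locExp k (currentSum t) (psiSeries f n v) =
      psiSeries (F * f) n (locExp k (currentSum t) v) := by
  obtain ⟨M, hM⟩ := exists_currentSum_pow_eq_zero t v
  obtain ⟨D, hD⟩ := exists_psi_currentSum_pow_eq_zero t n v hM
  set A := currentSum t with hA
  let c : ℕ → R := fun i => algebraMap k R ((i.factorial : k)⁻¹)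
  let φ : ℕ × ℕ → Fock R := fun p =>
    (c p.1 * c p.2) • psiSeries ((X * mk t) ^ p.1 * f) n ((A ^ p.2) v)
  have hφ1 : ∀ p : ℕ × ℕ, D ≤ p.1 → φ p = 0 := fun p hp => by
    simp only [φ]
    rw [psiSeries_eq_zero (fun d hd => hD d hd _) (X_pow_dvd_pow_mul _ _ hp), smul_zero]
  have hφ2 : ∀ p : ℕ × ℕ, M ≤ p.2 → φ p = 0 := fun p hp => by
    simp only [φ]
    rw [hM _ hp, map_zero, smul_zero]
  have hpow : ∀ m, c m • (A ^ m) (psiSeries f n v) =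
      ∑ p ∈ Finset.HasAntidiagonal.antidiagonal m, φ p := by
    intro m
    rw [hA, currentSum_pow_psiSeries, Finset.smul_sum]
    refine Finset.sum_congr rfl fun p hp => ?_
    rw [Finset.HasAntidiagonal.mem_antidiagonal] at hp
    simp only [φ, ← Nat.cast_smul_eq_nsmul R, smul_smul, c]
    congr 1
    rw [← hp, ← map_mul, ← factorial_inv_mul_choose, map_mul, map_natCast]
  have h1 : locExp k A (psiSeries f n v) =
      ∑ m ∈ Finset.range (D + M), c m • (A ^ m) (psiSeries f n v) := by
    refine locExp_currentSum_apply k fun m hm => ?_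
    rw [currentSum_pow_psiSeries]
    refine Finset.sum_eq_zero fun p hp => ?_
    rw [Finset.HasAntidiagonal.mem_antidiagonal] at hp
    rcases le_or_gt M p.2 with h | h
    · rw [hM _ h, map_zero, smul_zero]
    · rw [psiSeries_eq_zero (fun d hd => hD d hd _) (X_pow_dvd_pow_mul _ _ (by omega)), smul_zero]
  -- All nonzero terms `φ p` lie in the box `D × M`, so grouping by antidiagonals and summing over
  -- the box agree.
  have h2 : ∑ m ∈ Finset.range (D + M), c m • (A ^ m) (psiSeries f n v) =
      ∑ p ∈ Finset.range D ×ˢ Finset.range M, φ p := by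
    rw [← Finset.sum_fiberwise_of_maps_to (s := Finset.range D ×ˢ Finset.range M)
      (t := Finset.range (D + M)) (g := fun p => p.1 + p.2)]
    · refine Finset.sum_congr rfl fun m hm => ?_
      rw [hpow]
      symm
      refine Finset.sum_subset (fun p hp => ?_) fun p hp hp' => ?_
      · rw [Finset.mem_filter] at hp
        rw [Finset.HasAntidiagonal.mem_antidiagonal, hp.2]
      · rw [Finset.HasAntidiagonal.mem_antidiagonal] at hp
        rw [Finset.mem_filter, Finset.mem_product, Finset.mem_range, Finset.mem_range] at hp'
        rcases le_or_gt D p.1 with h | h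
        · exact hφ1 p h
        · exact hφ2 p (by by_contra h'; exact hp' ⟨⟨h, by omega⟩, hp⟩)
    · intro p hp
      rw [Finset.mem_product, Finset.mem_range, Finset.mem_range] at hp
      rw [Finset.mem_range]
      omega
  rw [h1, h2, locExp_currentSum_apply k hM, map_sum, Finset.sum_product_right]
  refine Finset.sum_congr rfl fun j _ => ?_
  have h3 := X_pow_dvd_sub_exp k (T := X * mk t) (by simp) hF hFT D
  have h4 : psiSeries (F * f) n ((A ^ j) v) = psiSeries ((∑ i ∈ Finset.range D,
      algebraMap k R ((i.factorial : k)⁻¹) • (X * mk t) ^ i) * f) n ((A ^ j) v) := by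
    refine psiSeries_congr (fun d hd => hD d hd j) ?_
    rw [← sub_mul]
    exact h3.mul_right _
  rw [map_smul, h4, Finset.sum_mul, ← psiSeriesLin_apply, map_sum, LinearMap.sum_apply,
    Finset.smul_sum]
  refine Finset.sum_congr rfl fun i _ => ?_
  simp only [φ, c]
  rw [smul_mul_assoc, map_smul, LinearMap.smul_apply, smul_smul, psiSeriesLin_apply, mul_comm]

/-- The vector `f_1(z)ψ(z)|_{n_1} ⋯ f_s(z)ψ(z)|_{n_s} |-r⟩`. -/
def psiVec {s : ℕ} (f : Fin s → R⟦X⟧) (n : Fin s → ℤ) (r : ℕ) : Fock R :=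
  (List.ofFn fun i => psiSeries (f i) (n i)).prod (shiftedVac R r)

lemma psiVec_zero (f : Fin 0 → R⟦X⟧) (n : Fin 0 → ℤ) (r : ℕ) : psiVec f n r = shiftedVac R r := by
  simp [psiVec]

lemma psiVec_succ {s : ℕ} (f : Fin (s + 1) → R⟦X⟧) (n : Fin (s + 1) → ℤ) (r : ℕ) :
    psiVec f n r = psiSeries (f 0) (n 0) (psiVec (fun i => f i.succ) (fun i => n i.succ) r) := by
  simp [psiVec, List.ofFn_succ]

lemma locExp_currentSum_psiVec [CharZero k] {t : ℕ → R} {F : R⟦X⟧}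
    (hF : constantCoeff F = 1) (hFT : derivative R F = derivative R (X * mk t) * F)
    {s : ℕ} (f : Fin s → R⟦X⟧) (n : Fin s → ℤ) (r : ℕ) :
    locExp k (currentSum t) (psiVec f n r) = psiVec (fun i => F * f i) n r := by
  induction s with
  | zero => rw [psiVec_zero, psiVec_zero, locExp_currentSum_shiftedVac]
  | succ s ih => rw [psiVec_succ, psiVec_succ, locExp_currentSum_psiSeries k hF hFT, ih]

/-- Every exponential is pushed to the right until it is absorbed by `|-r⟩`. It contributes one `F`
to each field it passes, and factor `i` has `i` exponentials to its left. -/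
lemma prod_psiSeries_mul_locExp [CharZero k] {t : ℕ → R} {F : R⟦X⟧}
    (hF : constantCoeff F = 1) (hFT : derivative R F = derivative R (X * mk t) * F)
    {s : ℕ} (f : Fin s → R⟦X⟧) (n : Fin s → ℤ) (r : ℕ) :
    (List.ofFn fun i => psiSeries (f i) (n i) * locExp k (currentSum t)).prod (shiftedVac R r) =
      psiVec (fun i => F ^ (i : ℕ) * f i) n r := by
  induction s with
  | zero => simp [psiVec_zero]
  | succ s ih =>
    rw [List.ofFn_succ, List.prod_cons, Module.End.mul_apply, Module.End.mul_apply, ih,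
      locExp_currentSum_psiVec k hF hFT, psiVec_succ]
    simp [pow_succ', mul_assoc]

end Exponential

/-! ## Wick's theorem -/

section Wick

open PowerSeries

variable {R : Type*} [CommRing R]

/-- The coefficient of `z^n` of a power series, for an integer `n`. -/
def coeffInt (n : ℤ) (f : R⟦X⟧) : R := if 0 ≤ n then coeff n.toNat f else 0

lemma coeffInt_natCast (n : ℕ) (f : R⟦X⟧) : coeffInt (n : ℤ) f = coeff n f := by
  simp [coeffInt]

lemma coeffInt_of_neg {n : ℤ} (h : n < 0) (f : R⟦X⟧) : coeffInt n f = 0 := if_neg (not_le.2 h)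

lemma psi_apply_of_mem {n : ℤ} {S : Maya} (h : n ∈ S.carrier) (v : Fock R) :
    psi R n v S = (-1) ^ (S.erase n).above n * v (S.erase n) := by
  classical
  refine fock_ext (A := Finsupp.lapply S ∘ₗ psi R n)
    (B := (-1 : R) ^ (S.erase n).above n • Finsupp.lapply (S.erase n)) (fun T => ?_) v
  simp only [LinearMap.coe_comp, Function.comp_apply, Finsupp.lapply_apply, LinearMap.smul_apply]
  by_cases hT : n ∈ T.carrier
  · rw [psi_of_mem hT, Finsupp.single_apply, if_neg]
    · simp
    · rintro rfl
      simp at hT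
  · rw [psi_of_notMem hT, Finsupp.smul_apply, Finsupp.single_apply, Finsupp.single_apply]
    by_cases hTS : T = S.erase n
    · rw [if_pos hTS, if_pos, hTS]
      rw [hTS, Maya.insert_erase S h]
    · rw [if_neg hTS, if_neg, smul_zero, smul_zero]
      intro h'
      exact hTS (by rw [← h', Maya.erase_insert T hT])

lemma psi_apply_of_notMem {n : ℤ} {S : Maya} (h : n ∉ S.carrier) (v : Fock R) :
    psi R n v S = 0 := by
  classical
  refine fock_ext (A := Finsupp.lapply S ∘ₗ psi R n) (B := 0) (fun T => ?_) v
  simp only [LinearMap.coe_comp, Function.comp_apply, Finsupp.lapply_apply, LinearMap.zero_apply]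
  by_cases hT : n ∈ T.carrier
  · rw [psi_of_mem hT, Finsupp.zero_apply]
  · rw [psi_of_notMem hT, Finsupp.smul_apply, Finsupp.single_apply, if_neg, smul_zero]
    rintro rfl
    simp at h

lemma psiSeries_apply_eq_zero (f : R⟦X⟧) (n : ℤ) (v : Fock R) (S : Maya)
    (h : ∀ j ∈ S.carrier, j ≤ n → v (S.erase j) = 0) : psiSeries f n v S = 0 := by
  obtain ⟨D, hD⟩ := exists_psi_eq_zero n v
  rw [psiSeries_apply f hD, Finsupp.finsetSum_apply]
  refine Finset.sum_eq_zero fun d _ => ?_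
  rw [Finsupp.smul_apply]
  by_cases hS : n - d ∈ S.carrier
  · rw [psi_apply_of_mem hS, h _ hS (by omega), mul_zero, smul_zero]
  · rw [psi_apply_of_notMem hS, smul_zero]

/-- The operators only add indices to `|-r⟩`, so an index below `-r` is never missing. -/
lemma psiVec_apply_eq_zero {s : ℕ} (f : Fin s → R⟦X⟧) (n : Fin s → ℤ) (r : ℕ) (S : Maya) {m : ℤ}
    (hm : m < -r) (hS : m ∉ S.carrier) : psiVec f n r S = 0 := by
  classical
  induction s generalizing S with
  | zero =>
    rw [psiVec_zero, shiftedVac_eq, Finsupp.single_apply, if_neg]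
    rintro rfl
    exact hS hm
  | succ s ih =>
    rw [psiVec_succ]
    refine psiSeries_apply_eq_zero _ _ _ _ fun j hj _ => ih _ _ _ ?_
    simp [hS]

/-- The coefficients of a wedge of `s` vectors with `|-r⟩` are the minors. -/
lemma psiVec_apply {s : ℕ} (f : Fin s → R⟦X⟧) (n : Fin s → ℤ) (r : ℕ) (S : Maya) (b : Fin s → ℤ)
    (hb : StrictAnti b) (hbr : ∀ i, -(r : ℤ) ≤ b i)
    (hS : ∀ i, i ∈ S.carrier ↔ i ∈ Set.range b ∨ i < -r) :
    psiVec f n r S = (Matrix.of fun i j => coeffInt (n i - b j) (f i)).det := by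
  classical
  induction s generalizing S with
  | zero =>
    have : S = Maya.below r := by
      ext i
      simp [hS]
    rw [psiVec_zero, shiftedVac_eq, this]
    simp
  | succ s ih =>
    have hmem : ∀ j, b j ∈ S.carrier := fun j => (hS _).2 (Or.inl ⟨j, rfl⟩)
    set v := psiVec (fun i => f i.succ) (fun i => n i.succ) r with hv
    have hminor : ∀ j, v (S.erase (b j)) = (Matrix.of fun i l : Fin s =>
        coeffInt (n i.succ - b (j.succAbove l)) (f i.succ)).det := by
      intro j
      refine ih _ _ _ (fun l => b (j.succAbove l)) (hb.comp_strictMono (Fin.strictMono_succAbove j))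
        (fun l => hbr _) fun i => ?_
      rw [Maya.mem_erase, hS]
      constructor
      · rintro ⟨h1, ⟨l, rfl⟩ | h2⟩
        · obtain ⟨l, rfl⟩ := Fin.exists_succAbove_eq (x := l) (y := j) (by rintro rfl; exact h1 rfl)
          exact Or.inl ⟨l, rfl⟩
        · exact Or.inr h2
      · rintro (⟨l, rfl⟩ | h)
        · exact ⟨fun h => Fin.succAbove_ne j l (hb.injective h), Or.inl ⟨_, rfl⟩⟩
        · exact ⟨by have := hbr j; omega, Or.inr h⟩
    -- As `b` decreases, exactly `b 0, …, b (j - 1)` lie above `b j`; the fermionic sign is thus the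
    -- sign in the Laplace expansion along row 0.
    have habove : ∀ j, (S.erase (b j)).above (b j) = (j : ℕ) := by
      intro j
      have : {i | i ∈ (S.erase (b j)).carrier ∧ b j < i} = b '' (Finset.Iio j : Set (Fin (s + 1))) := by
        ext i
        simp only [Maya.mem_erase, hS, Set.mem_ofPred_eq, Set.mem_image, Finset.coe_Iio, Set.mem_Iio,
          Set.mem_range]
        constructor
        · rintro ⟨⟨_, ⟨l, rfl⟩ | h⟩, h'⟩
          · exact ⟨l, hb.lt_iff_gt.1 h', rfl⟩
          · have := hbr j
            omega
        · rintro ⟨l, hl, rfl⟩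
          exact ⟨⟨(hb hl).ne', Or.inl ⟨l, rfl⟩⟩, hb hl⟩
      rw [Maya.above, this, Set.ncard_image_of_injective _ hb.injective, Set.ncard_coe_finset,
        Fin.card_Iio]
    rw [psiVec_succ, Matrix.det_succ_row_zero]
    obtain ⟨D, hD, hbD⟩ : ∃ D : ℕ, (∀ d ≥ D, psi R (n 0 - d) v = 0) ∧
        ∀ j, n 0 - b j < D := by
      obtain ⟨D, hD⟩ := exists_psi_eq_zero (n 0) v
      refine ⟨max D (n 0 + r + 1).toNat, fun d hd => hD d (le_of_max_le_left hd), fun j => ?_⟩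
      have := hbr j
      have : n 0 + r + 1 ≤ max D (n 0 + r + 1).toNat := by
        push_cast
        exact (Int.self_le_toNat _).trans (le_max_right _ _)
      omega
    have hcoef : ∀ j, coeffInt (n 0 - b j) (f 0) * psi R (b j) v S =
        ∑ d ∈ Finset.range D, if n 0 - d = b j then coeff d (f 0) * psi R (n 0 - d) v S else 0 := by
      intro j
      by_cases h0 : 0 ≤ n 0 - b j
      · rw [Finset.sum_eq_single (n 0 - b j).toNat]
        · have : n 0 - ((n 0 - b j).toNat : ℤ) = b j := by omega
          rw [if_pos this, this, coeffInt, if_pos h0]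
        · intro d _ hd
          rw [if_neg]
          omega
        · intro h
          have := hbD j
          rw [Finset.mem_range] at h
          omega
      · rw [coeffInt, if_neg h0, zero_mul]
        symm
        refine Finset.sum_eq_zero fun d _ => if_neg (by omega)
    have hterm : ∀ j : Fin (s + 1), (-1) ^ (j : ℕ) * (Matrix.of fun i j => coeffInt (n i - b j) (f i)) 0 j *
        ((Matrix.of fun i j => coeffInt (n i - b j) (f i)).submatrix Fin.succ j.succAbove).det =
        ∑ d ∈ Finset.range D, if n 0 - d = b j then coeff d (f 0) * psi R (n 0 - d) v S else 0 := by
      intro j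
      rw [← hcoef, psi_apply_of_mem (hmem j), habove, hminor, Matrix.of_apply, mul_comm _ (coeffInt _ _),
        mul_assoc]
      rfl
    rw [Finset.sum_congr rfl fun j _ => hterm j, Finset.sum_comm, psiSeries_apply _ hD,
      Finsupp.finsetSum_apply]
    refine Finset.sum_congr rfl fun d _ => ?_
    rw [Finsupp.smul_apply, smul_eq_mul]
    by_cases hd : n 0 - d ∈ S.carrier
    · rcases (hS _).1 hd with ⟨j, hj⟩ | h
      · rw [Finset.sum_eq_single j]
        · rw [if_pos hj.symm]
        · intro l _ hl
          rw [if_neg]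
          intro h
          exact hl (hb.injective (by rw [← h, hj]))
        · simp
      -- An index below `-r` cannot be the one just added, as it was present from the start.
      · rw [psi_apply_of_mem hd, psiVec_apply_eq_zero _ _ _ _ h (by simp)]
        simp
    · rw [psi_apply_of_notMem hd]
      simp

lemma vacCoeff_psiVec {r : ℕ} (f : Fin r → R⟦X⟧) (n : Fin r → ℤ) :
    vacCoeff R (psiVec f n r) =
      (Matrix.of fun i j : Fin r => coeffInt (n i + ((j : ℤ) + 1)) (f i)).det := by
  have h := psiVec_apply f n r Maya.vacuum (fun j => -((j : ℤ) + 1)) ?_ ?_ ?_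
  · simpa only [sub_neg_eq_add, vacCoeff, Finsupp.lapply_apply] using h
  · intro i j hij
    simp only
    omega
  · intro i
    omega
  · intro i
    simp only [Maya.vacuum, Set.mem_ofPred_eq, Set.mem_range]
    constructor
    · intro h
      by_cases h' : i < -r
      · exact Or.inr h'
      · exact Or.inl ⟨⟨(-i - 1).toNat, by omega⟩, by simp only; omega⟩
    · rintro (⟨j, rfl⟩ | h) <;> omega

end Wick

end StableGrothendieck
end

noncomputable section
namespace StableGrothendieck

/-! ## The determinant formula for the dual polynomials -/

section

variable (k : Type*) [Field k]

lemma SymFun.ext' {f g : SymFun k}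
    (h : ∀ d : ℕ →₀ ℕ, MvPowerSeries.coeff d f.1 = MvPowerSeries.coeff d g.1) : f = g :=
  Subtype.ext (MvPowerSeries.ext h)

lemma coeff_completeSym (n : ℕ) (d : ℕ →₀ ℕ) :
    MvPowerSeries.coeff d (completeSym k n).1 = if d.degree = n then 1 else 0 := rfl

open Classical in
lemma coeff_powerSum (n : ℕ) (d : ℕ →₀ ℕ) : MvPowerSeries.coeff d (powerSum k n).1 =
    if ∃ i, d = Finsupp.single i n then 1 else 0 := rfl

/-- The inclusion of `Λ` into the power series ring. -/
def symVal : SymFun k →ₐ[k] MvPowerSeries ℕ k := (symSubalgebra k).val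

lemma symVal_apply (f : SymFun k) : symVal k f = f.1 := rfl

-- A splitting of the monomial `d` as `x_s^{i+1}` times a remainder is a choice of a variable `s`
-- and of `i < d s`; the number of choices is the degree of `d`.
open Classical in
lemma newton_count (n : ℕ) (d : ℕ →₀ ℕ) (hd : d.degree = n + 1) :
    ((Finset.HasAntidiagonal.antidiagonal n ×ˢ Finset.HasAntidiagonal.antidiagonal d).filter
      fun p : (ℕ × ℕ) × ((ℕ →₀ ℕ) × (ℕ →₀ ℕ)) =>
        (∃ s, p.2.1 = Finsupp.single s (p.1.1 + 1)) ∧ p.2.2.degree = p.1.2).card = n + 1 := by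
  classical
  have hc : (d.support.sigma fun s => Finset.range (d s)).card = n + 1 := by
    rw [Finset.card_sigma, ← hd, Finsupp.degree_apply]
    simp
  rw [← hc]
  symm
  refine Finset.card_bij (fun x _ => ((x.2, n - x.2),
    (Finsupp.single x.1 (x.2 + 1), d - Finsupp.single x.1 (x.2 + 1)))) ?_ ?_ ?_
  · rintro ⟨s, i⟩ h
    simp only [Finset.mem_sigma, Finset.mem_range] at h
    have hle : Finsupp.single s (i + 1) ≤ d := by
      rw [Finsupp.single_le_iff]
      omega
    have hadd : Finsupp.single s (i + 1) + (d - Finsupp.single s (i + 1)) = d :=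
      add_tsub_cancel_of_le hle
    have hdeg := congrArg Finsupp.degree hadd
    rw [map_add, Finsupp.degree_single, hd] at hdeg
    simp only [Finset.mem_filter, Finset.mem_product, Finset.HasAntidiagonal.mem_antidiagonal]
    exact ⟨⟨by omega, hadd⟩, ⟨s, rfl⟩, by omega⟩
  · rintro ⟨s, i⟩ _ ⟨t, j⟩ _ h
    simp only [Prod.mk.injEq] at h
    obtain ⟨⟨rfl, _⟩, h, _⟩ := h
    rw [Finsupp.single_eq_single_iff] at h
    obtain ⟨rfl, _⟩ | h := h
    · rfl
    · omega
  · rintro ⟨⟨i, j⟩, ⟨a, b⟩⟩ h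
    simp only [Finset.mem_filter, Finset.mem_product, Finset.HasAntidiagonal.mem_antidiagonal] at h
    obtain ⟨⟨hij, hab⟩, ⟨s, rfl⟩, hb⟩ := h
    have hs := DFunLike.congr_fun hab s
    simp only [Finsupp.add_apply, Finsupp.single_eq_same] at hs
    refine ⟨⟨s, i⟩, ?_, ?_⟩
    · simp only [Finset.mem_sigma, Finset.mem_range, Finsupp.mem_support_iff]
      omega
    · simp only [Prod.mk.injEq]
      refine ⟨⟨trivial, by omega⟩, trivial, ?_⟩
      rw [← hab, add_tsub_cancel_left]

/-- Newton's identity. -/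
lemma newton (n : ℕ) : ((n : SymFun k) + 1) * completeSym k (n + 1) =
    ∑ p ∈ Finset.HasAntidiagonal.antidiagonal n, powerSum k (p.1 + 1) * completeSym k p.2 := by
  classical
  refine SymFun.ext' k fun d => ?_
  have hl : (((n : SymFun k) + 1) * completeSym k (n + 1)).1 =
      (((n + 1 : ℕ) : k)) • (completeSym k (n + 1)).1 := by
    rw [← symVal_apply, ← symVal_apply, ← map_smul]
    congr 1
    rw [Algebra.smul_def]
    simp
  have hr : (∑ p ∈ Finset.HasAntidiagonal.antidiagonal n,
      powerSum k (p.1 + 1) * completeSym k p.2).1 =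
      ∑ p ∈ Finset.HasAntidiagonal.antidiagonal n,
        (powerSum k (p.1 + 1)).1 * (completeSym k p.2).1 := by
    rw [← symVal_apply, map_sum]
    rfl
  rw [hl, hr, map_smul, map_sum]
  simp only [MvPowerSeries.coeff_mul, coeff_completeSym, coeff_powerSum, mul_ite, mul_one, mul_zero,
    ← ite_and]
  rw [← Finset.sum_product', Finset.sum_boole]
  by_cases hd : d.degree = n + 1
  · have h := newton_count n d hd
    simp only [and_comm] at h ⊢
    rw [h, if_pos hd, smul_eq_mul, mul_one]
  · rw [if_neg hd, smul_zero, Finset.filter_eq_empty_iff.2, Finset.card_empty, Nat.cast_zero]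
    rintro ⟨⟨i, j⟩, ⟨a, b⟩⟩ h
    simp only [Finset.mem_product, Finset.HasAntidiagonal.mem_antidiagonal] at h ⊢
    rintro ⟨hb, s, rfl⟩
    refine hd ?_
    rw [← h.2, map_add, Finsupp.degree_single, hb]
    omega

open PowerSeries

/-- The generating function of the complete symmetric functions. -/
def completeSeries : PowerSeries (SymFun k) := mk (completeSym k)

lemma completeSym_zero : completeSym k 0 = 1 := by
  classical
  refine SymFun.ext' k fun d => ?_
  rw [coeff_completeSym]
  have : (1 : SymFun k).1 = (1 : MvPowerSeries ℕ k) := rfl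
  rw [this, MvPowerSeries.coeff_one]
  simp [Finsupp.degree_eq_zero_iff]

/-- The power series `1 / (1 + β z)`. -/
def invOneAdd (β : k) : PowerSeries k := mk fun n => (-β) ^ n

lemma one_add_mul_invOneAdd (β : k) : (1 + C β * X) * invOneAdd k β = 1 := by
  ext n
  rcases n with _ | n
  · simp [invOneAdd]
  · rw [add_mul, one_mul, mul_assoc, map_add, coeff_C_mul, coeff_succ_X_mul, invOneAdd, coeff_mk,
      coeff_mk, PowerSeries.coeff_one, if_neg n.succ_ne_zero]
    ring

lemma neg_theta (β : k) : -theta k β = currentSum fun n : ℕ =>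
    -algebraMap k (SymFun k) ((-1) ^ n * β ^ (n + 1) * ((n : k) + 1)⁻¹) := by
  refine LinearMap.ext fun v => ?_
  rw [LinearMap.neg_apply, theta, currentSum, locSum_apply (locFinite_currentSum _),
    locSum_apply (locFinite_currentSum _), ← finsum_neg_distrib]
  simp [neg_smul]

variable [CharZero k]

lemma algebraMap_succ_inv_mul {R : Type*} [CommRing R] [Algebra k R] (n : ℕ) :
    algebraMap k R (((n : k) + 1)⁻¹) * ((n : R) + 1) = 1 := by
  have h1 : ((n : k) + 1) ≠ 0 := by exact_mod_cast n.succ_ne_zero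
  have h2 : algebraMap k R ((n : k) + 1) = (n : R) + 1 := by simp
  rw [← h2, ← map_mul, inv_mul_cancel₀ h1, map_one]

/-- Newton's identities are, coefficient by coefficient, the differential equation of `exp (∑ p_m
z^m / m)`. -/
lemma derivative_completeSeries : derivative (SymFun k) (completeSeries k) =
    derivative (SymFun k) (X * mk fun n : ℕ =>
      algebraMap k (SymFun k) (((n : k) + 1)⁻¹) * powerSum k (n + 1)) * completeSeries k := by
  ext1 n
  rw [PowerSeries.coeff_derivative, PowerSeries.coeff_mul, completeSeries, coeff_mk, mul_comm, newton]
  refine Finset.sum_congr rfl fun p _ => ?_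
  rw [PowerSeries.coeff_derivative, PowerSeries.coeff_succ_X_mul, coeff_mk, coeff_mk]
  linear_combination -(powerSum k (p.1 + 1) * completeSym k p.2) *
    algebraMap_succ_inv_mul k (R := SymFun k) p.1

variable (β : k)

lemma derivative_invOneAdd : derivative (SymFun k) (map (algebraMap k (SymFun k)) (invOneAdd k β)) =
    derivative (SymFun k) (X * mk fun n : ℕ =>
      -algebraMap k (SymFun k) ((-1) ^ n * β ^ (n + 1) * ((n : k) + 1)⁻¹)) *
        map (algebraMap k (SymFun k)) (invOneAdd k β) := by
  ext1 n
  rw [PowerSeries.coeff_derivative, PowerSeries.coeff_mul]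
  -- The product of the two coefficients does not depend on the splitting of `n`, so the sum is just
  -- a count of `n + 1` equal terms.
  have : ∀ p ∈ Finset.HasAntidiagonal.antidiagonal n,
      coeff p.1 (derivative (SymFun k) (X * mk fun n : ℕ =>
      -algebraMap k (SymFun k) ((-1) ^ n * β ^ (n + 1) * ((n : k) + 1)⁻¹))) *
        coeff p.2 (map (algebraMap k (SymFun k)) (invOneAdd k β)) =
      algebraMap k (SymFun k) ((-β) ^ (n + 1)) := by
    intro p hp
    rw [Finset.HasAntidiagonal.mem_antidiagonal] at hp
    rw [PowerSeries.coeff_derivative, PowerSeries.coeff_succ_X_mul, coeff_mk, coeff_map, invOneAdd,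
      coeff_mk, map_mul _ (_ * _), ← neg_mul, mul_assoc _ _ ((p.1 : SymFun k) + 1),
      algebraMap_succ_inv_mul, mul_one, ← map_neg, ← map_mul, ← hp]
    congr 1
    ring
  rw [Finset.sum_congr rfl this, Finset.sum_const, Finset.Nat.card_antidiagonal, coeff_map,
    invOneAdd, coeff_mk, nsmul_eq_mul, mul_comm]
  push_cast
  rfl

lemma dualGrothendieck_eq_det (μ : YoungDiagram) (r : ℕ) : dualGrothendieck k β μ r =
    (Matrix.of fun i j : Fin r => coeffInt ((μ.rowLen i : ℤ) - (i : ℤ) + (j : ℤ))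
      (completeSeries k * map (algebraMap k (SymFun k)) (invOneAdd k β) ^ (i : ℕ))).det := by
  have hψ : ∀ n : ℤ, psi (SymFun k) n = psiSeries 1 n := fun n =>
    LinearMap.ext fun v => (psiSeries_one n v).symm
  unfold dualGrothendieck
  simp only [hψ, neg_theta]
  rw [prod_psiSeries_mul_locExp k _ (derivative_invOneAdd k β)]
  · have : hamiltonian k = currentSum fun n : ℕ =>
        algebraMap k (SymFun k) (((n : k) + 1)⁻¹) * powerSum k (n + 1) := rfl
    rw [this, locExp_currentSum_psiVec k _ (derivative_completeSeries k), vacCoeff_psiVec]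
    · congr 1
      ext i j
      simp only [Matrix.of_apply, mul_one]
      congr 1
      ring
    · simp [completeSeries, completeSym_zero]
  · rw [← coeff_zero_eq_constantCoeff_apply, coeff_map, invOneAdd, coeff_mk, pow_zero, map_one]

end

end StableGrothendieck
end

noncomputable section
namespace StableGrothendieck

/-! ## The Jacobi–Trudi identity -/

section JacobiTrudi

variable {k : Type*} [Field k] {K : Type*} [CommRing K] [Algebra k K]

lemma basisMonomials_eq_X_pow (k : Type*) [Field k] (a : ℕ) :
    Polynomial.basisMonomials k a = Polynomial.X ^ a := by
  simp [Polynomial.X_pow_eq_monomial]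

/-- The linear map sending the monomial `x^a` to `(H_{a - N + 1 + j})_{0 ≤ j < N}`. -/
def jtRow (k : Type*) [Field k] {K : Type*} [CommRing K] [Algebra k K] (H : PowerSeries K) (N : ℕ) :
    Polynomial k →ₗ[k] (Fin N → K) :=
  (Polynomial.basisMonomials k).constr k fun a j => coeffInt ((a : ℤ) - N + 1 + (j : ℤ)) H

lemma jtRow_X_pow (H : PowerSeries K) (N a : ℕ) (j : Fin N) :
    jtRow k H N (Polynomial.X ^ a) j = coeffInt ((a : ℤ) - N + 1 + (j : ℤ)) H := by
  rw [← basisMonomials_eq_X_pow, jtRow, Module.Basis.constr_basis]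

/-- The determinant `det (∑_a v_{i,a} H_{a - N + 1 + j})` for polynomials `v_i = ∑_a v_{i,a} x^a`. -/
def jt (k : Type*) [Field k] {K : Type*} [CommRing K] [Algebra k K] (H : PowerSeries K) (N : ℕ) :
    Polynomial k [⋀^Fin N]→ₗ[k] K where
  toMultilinearMap := ((Matrix.detRowAlternating (n := Fin N) (R := K)).toMultilinearMap.restrictScalars
    k).compLinearMap fun _ => jtRow k H N
  map_eq_zero_of_eq' v i j h hij := by
    change Matrix.det (fun i => jtRow k H N (v i)) = 0
    exact Matrix.det_zero_of_row_eq hij (by rw [h])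

lemma jt_apply (H : PowerSeries K) (N : ℕ) (v : Fin N → Polynomial k) :
    jt k H N v = (Matrix.of fun i => jtRow k H N (v i)).det := rfl

/-- For `Q` of degree less than `N`, only the `N` coefficients of `H` that make up the row `jtRow`
of `x^a` enter. -/
lemma coeff_mul_eq_sum_coeffInt (H Q : PowerSeries K) (N a : ℕ)
    (hQ : ∀ m ≥ N, PowerSeries.coeff m Q = 0) : PowerSeries.coeff a (H * Q) =
      ∑ j : Fin N, coeffInt ((a : ℤ) - N + 1 + (j : ℤ)) H * PowerSeries.coeff (N - 1 - (j : ℕ)) Q := by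
  let g : ℕ → K := fun m => coeffInt ((a : ℤ) - m) H * PowerSeries.coeff m Q
  have h1 : ∑ j : Fin N, coeffInt ((a : ℤ) - N + 1 + (j : ℤ)) H *
      PowerSeries.coeff (N - 1 - (j : ℕ)) Q = ∑ m ∈ Finset.range N, g m := by
    rw [← Finset.sum_range_reflect, ← Fin.sum_univ_eq_sum_range (fun j => g (N - 1 - j))]
    refine Finset.sum_congr rfl fun j _ => ?_
    simp only [g]
    have : (a : ℤ) - ((N - 1 - (j : ℕ) : ℕ) : ℤ) = (a : ℤ) - N + 1 + (j : ℤ) := by omega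
    rw [this]
  have h2 : PowerSeries.coeff a (H * Q) = ∑ m ∈ Finset.range (a + 1), g m := by
    rw [mul_comm, PowerSeries.coeff_mul, Finset.Nat.sum_antidiagonal_eq_sum_range_succ
      (fun i j => PowerSeries.coeff i Q * PowerSeries.coeff j H)]
    refine Finset.sum_congr rfl fun m hm => ?_
    rw [Finset.mem_range] at hm
    simp only [g]
    have : (a : ℤ) - (m : ℤ) = ((a - m : ℕ) : ℤ) := by omega
    rw [this, coeffInt_natCast, mul_comm]
  have h3 : ∑ m ∈ Finset.range N, g m = ∑ m ∈ Finset.range (N + (a + 1)), g m := by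
    refine Finset.sum_subset (Finset.range_mono (by omega)) fun m _ hm => ?_
    simp only [g]
    rw [hQ m (by simpa using hm), mul_zero]
  have h4 : ∑ m ∈ Finset.range (a + 1), g m = ∑ m ∈ Finset.range (N + (a + 1)), g m := by
    refine Finset.sum_subset (Finset.range_mono (by omega)) fun m _ hm => ?_
    simp only [g]
    rw [Finset.mem_range] at hm
    rw [coeffInt_of_neg (by omega), zero_mul]
  rw [h1, h2, h3, h4]

lemma geom_mul_one_sub (y : K) :
    PowerSeries.mk (fun n => y ^ n) * (1 - PowerSeries.C y * PowerSeries.X) = 1 := by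
  ext n
  rw [mul_sub, mul_one, mul_left_comm, map_sub, PowerSeries.coeff_C_mul]
  rcases n with _ | n
  · simp
  · rw [PowerSeries.coeff_succ_mul_X, PowerSeries.coeff_mk, PowerSeries.coeff_mk,
      PowerSeries.coeff_one, if_neg n.succ_ne_zero]
    ring

/-- The Jacobi–Trudi identity: if `H(z) = ∏ 1 / (1 - y_i z)`, then `jt H v` is the quotient of two
alternants. -/
lemma jt_mul_vandermonde (H : PowerSeries K) {N : ℕ} (y : Fin N → K)
    (hH : H * ∏ i, (1 - PowerSeries.C (y i) * PowerSeries.X) = 1) (v : Fin N → Polynomial k) :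
    jt k H N v * (Matrix.of fun i j : Fin N => y i ^ (N - 1 - (j : ℕ))).det =
      (Matrix.of fun i j : Fin N => Polynomial.aeval (y i) (v j)).det := by
  classical
  -- Leaving out the factor of `y l` gives `H * Q l = 1 / (1 - y_l z)`, whose coefficient at `z^a`
  -- is the value of `x^a` at `y l`.
  let Q : Fin N → Polynomial K := fun l =>
    ∏ i ∈ Finset.univ.erase l, (1 - Polynomial.C (y i) * Polynomial.X)
  have hQdeg : ∀ l, ∀ m ≥ N, PowerSeries.coeff m (Q l : PowerSeries K) = 0 := by
    intro l m hm
    rw [Polynomial.coeff_coe]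
    refine Polynomial.coeff_eq_zero_of_natDegree_lt ?_
    have h1 : (Q l).natDegree ≤ ∑ i ∈ Finset.univ.erase l, 1 :=
      (Polynomial.natDegree_prod_le _ _).trans
        (Finset.sum_le_sum fun i _ => by compute_degree)
    have := l.pos
    simp at h1
    omega
  have hQ : ∀ l, H * (Q l : PowerSeries K) = PowerSeries.mk fun n => y l ^ n := by
    intro l
    have h1 : (Q l : PowerSeries K) * (1 - PowerSeries.C (y l) * PowerSeries.X) =
        ∏ i, (1 - PowerSeries.C (y i) * PowerSeries.X) := by
      rw [← Finset.prod_erase_mul _ _ (Finset.mem_univ l)]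
      congr 1
      rw [← Polynomial.coeToPowerSeries.ringHom_apply, map_prod]
      simp
    calc H * (Q l : PowerSeries K) = H * ((Q l : PowerSeries K) *
          (1 - PowerSeries.C (y l) * PowerSeries.X)) * PowerSeries.mk fun n => y l ^ n := by
          rw [mul_assoc, mul_assoc, mul_comm (1 - _), geom_mul_one_sub, mul_one]
      _ = _ := by rw [h1, hH, one_mul]
  -- Right multiplication by `M` turns the row of a polynomial into its values at the `y l`. Since
  -- `M` does not depend on `v`, its determinant is found from the family `x^{N-1-i}`, for which the
  -- matrix of `jt` is unitriangular.
  let M : Matrix (Fin N) (Fin N) K :=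
    Matrix.of fun j l => PowerSeries.coeff (N - 1 - (j : ℕ)) (Q l : PowerSeries K)
  have key : ∀ (l : Fin N) (p : Polynomial k),
      ∑ j, jtRow k H N p j * M j l = Polynomial.aeval (y l) p := by
    intro l p
    let L : Polynomial k →ₗ[k] K :=
      ∑ j, (LinearMap.mulRight k (M j l)) ∘ₗ (LinearMap.proj j) ∘ₗ jtRow k H N
    have hL : L = (Polynomial.aeval (y l)).toLinearMap := by
      refine (Polynomial.basisMonomials k).ext fun a => ?_
      rw [basisMonomials_eq_X_pow]
      simp only [L, LinearMap.sum_apply, LinearMap.comp_apply, LinearMap.proj_apply,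
        LinearMap.mulRight_apply, jtRow_X_pow, AlgHom.toLinearMap_apply, map_pow,
        Polynomial.aeval_X, M, Matrix.of_apply]
      rw [← coeff_mul_eq_sum_coeffInt H _ N a (hQdeg l), hQ, PowerSeries.coeff_mk]
    have := LinearMap.congr_fun hL p
    simpa [L] using this
  have hmul : ∀ w : Fin N → Polynomial k, (Matrix.of fun i => jtRow k H N (w i)) * M =
      (Matrix.of fun i j : Fin N => Polynomial.aeval (y i) (w j)).transpose := by
    intro w
    ext i l
    rw [Matrix.mul_apply, Matrix.transpose_apply, Matrix.of_apply, ← key]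
    rfl
  have hdet : ∀ w : Fin N → Polynomial k, jt k H N w * M.det =
      (Matrix.of fun i j : Fin N => Polynomial.aeval (y i) (w j)).det := by
    intro w
    rw [jt_apply, ← Matrix.det_mul, hmul, Matrix.det_transpose]
  have hH0 : PowerSeries.coeff 0 H = 1 := by
    have h := congrArg PowerSeries.constantCoeff hH
    rw [map_mul, map_prod] at h
    simpa using h
  have hone : jt k H N (fun i => Polynomial.X ^ (N - 1 - (i : ℕ))) = 1 := by
    rw [jt_apply, Matrix.det_of_isUpperTriangular]
    · refine Finset.prod_eq_one fun i _ => ?_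
      rw [Matrix.of_apply, jtRow_X_pow, ← hH0, ← coeffInt_natCast]
      congr 1
      omega
    · intro i j hij
      simp only [id] at hij
      rw [Matrix.of_apply, jtRow_X_pow, coeffInt_of_neg]
      omega
  have hM : M.det = (Matrix.of fun i j : Fin N => y i ^ (N - 1 - (j : ℕ))).det := by
    have h := hdet fun i => Polynomial.X ^ (N - 1 - (i : ℕ))
    rw [hone, one_mul] at h
    simpa using h
  rw [← hM, hdet]

lemma map_coeffInt {L : Type*} [CommRing L] (φ : K →+* L) (n : ℤ) (H : PowerSeries K) :
    φ (coeffInt n H) = coeffInt n (PowerSeries.map φ H) := by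
  unfold coeffInt
  split_ifs
  · rw [PowerSeries.coeff_map]
  · exact map_zero φ

lemma map_jt {L : Type*} [CommRing L] [Algebra k L] (φ : K →ₐ[k] L) (H : PowerSeries K) (N : ℕ)
    (v : Fin N → Polynomial k) :
    φ (jt k H N v) = jt k (PowerSeries.map (φ : K →+* L) H) N v := by
  rw [jt_apply, jt_apply, AlgHom.map_det]
  congr 1
  ext i j
  change φ (jtRow k H N (v i) j) = jtRow k (PowerSeries.map (φ : K →+* L) H) N (v i) j
  have : φ.toLinearMap ∘ₗ LinearMap.proj j ∘ₗ jtRow k H N =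
      LinearMap.proj j ∘ₗ jtRow k (PowerSeries.map (φ : K →+* L) H) N := by
    refine (Polynomial.basisMonomials k).ext fun a => ?_
    rw [basisMonomials_eq_X_pow]
    simp only [LinearMap.comp_apply, LinearMap.proj_apply, jtRow_X_pow, AlgHom.toLinearMap_apply]
    exact map_coeffInt (φ : K →+* L) _ _
  exact LinearMap.congr_fun this (v i)

/-- A determinant whose last row is the last unit vector. -/
lemma det_eq_of_last_row {n : ℕ} (A : Matrix (Fin (n + 1)) (Fin (n + 1)) K)
    (h0 : ∀ j : Fin n, A (Fin.last n) j.castSucc = 0) (h1 : A (Fin.last n) (Fin.last n) = 1) :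
    A.det = (Matrix.of fun i j : Fin n => A i.castSucc j.castSucc).det := by
  rw [Matrix.det_succ_row A (Fin.last n), Fin.sum_univ_castSucc]
  simp only [h0, mul_zero, zero_mul, Finset.sum_const_zero, zero_add, h1, mul_one,
    Fin.succAbove_last, Fin.val_last]
  rw [← two_mul, pow_mul, neg_one_sq, one_pow, one_mul]
  rfl

end JacobiTrudi

/-! ### Restriction to finitely many variables and bialternants -/

section Restrict

variable (k : Type*) [Field k]

/-- The restriction to finitely many variables as an algebra homomorphism. -/
def restrictHom (n : ℕ) : SymFun k →ₐ[k] MvPowerSeries (Fin n) k :=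
  (MvPowerSeries.killCompl Fin.valEmbedding).comp (symVal k)

lemma coeff_restrict (n : ℕ) (f : SymFun k) (d : Fin n →₀ ℕ) :
    MvPowerSeries.coeff d (restrict k n f) = MvPowerSeries.coeff (d.mapDomain Fin.val) f.1 := rfl

lemma restrictHom_apply (n : ℕ) (f : SymFun k) : restrictHom k n f = restrict k n f := by
  ext d
  rw [coeff_restrict, restrictHom, AlgHom.comp_apply, MvPowerSeries.coeff_killCompl,
    Finsupp.embDomain_eq_mapDomain]
  rfl

lemma prod_X_pow_eq_monomial {n : ℕ} (e : Fin n →₀ ℕ) :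
    ∏ i, (MvPowerSeries.X i : MvPowerSeries (Fin n) k) ^ e i = MvPowerSeries.monomial e 1 := by
  classical
  simp only [MvPowerSeries.X_pow_eq]
  rw [MvPowerSeries.prod_monomial, Finset.prod_const_one, Finsupp.univ_sum_single]

/-- The generating function of the complete symmetric polynomials in `n` variables. -/
def completeSeriesFin (n : ℕ) : PowerSeries (MvPowerSeries (Fin n) k) :=
  PowerSeries.map (restrictHom k n : SymFun k →+* MvPowerSeries (Fin n) k) (completeSeries k)

lemma completeSeriesFin_eq (n : ℕ) : completeSeriesFin k n =
    ∏ i : Fin n, PowerSeries.mk fun m => (MvPowerSeries.X i : MvPowerSeries (Fin n) k) ^ m := by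
  classical
  ext m d
  rw [completeSeriesFin, PowerSeries.coeff_map, completeSeries, PowerSeries.coeff_mk,
    PowerSeries.coeff_prod, map_sum]
  simp only [PowerSeries.coeff_mk, prod_X_pow_eq_monomial, MvPowerSeries.coeff_monomial]
  rw [Finset.sum_ite_eq]
  change MvPowerSeries.coeff d (restrictHom k n (completeSym k m)) = _
  rw [restrictHom_apply, coeff_restrict, coeff_completeSym, Finsupp.degree_mapDomain]
  have : d ∈ Finset.finsuppAntidiag Finset.univ m ↔ d.degree = m := by
    rw [Finset.mem_finsuppAntidiag]
    simp [Finsupp.degree_eq_sum]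
  simp only [this]

lemma completeSeriesFin_mul (n : ℕ) : completeSeriesFin k n *
    ∏ i : Fin n, (1 - PowerSeries.C (MvPowerSeries.X i : MvPowerSeries (Fin n) k) *
      PowerSeries.X) = 1 := by
  rw [completeSeriesFin_eq, ← Finset.prod_mul_distrib]
  exact Finset.prod_eq_one fun i _ => geom_mul_one_sub _

lemma restrict_jt (n N : ℕ) (v : Fin N → Polynomial k) :
    restrict k n (jt k (completeSeries k) N v) = jt k (completeSeriesFin k n) N v := by
  rw [← restrictHom_apply, map_jt]
  rfl

lemma grothendieckDenominator_eq (n : ℕ) : grothendieckDenominator k n =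
    (Matrix.of fun i j : Fin n =>
      (MvPowerSeries.X i : MvPowerSeries (Fin n) k) ^ (n - 1 - (j : ℕ))).det := by
  have h := Matrix.det_projVandermonde (1 : Fin n → MvPowerSeries (Fin n) k) MvPowerSeries.X
  simp only [Pi.one_apply, one_mul] at h
  rw [grothendieckDenominator, ← h]
  congr 1
  ext i j : 1
  rw [Matrix.projVandermonde_apply, Matrix.of_apply, Pi.one_apply, one_pow, one_mul, Fin.val_rev]
  congr 1
  omega

lemma grothendieckDenominator_ne_zero (n : ℕ) : grothendieckDenominator k n ≠ 0 := by
  refine Finset.prod_ne_zero_iff.2 fun i _ => Finset.prod_ne_zero_iff.2 fun j hj => ?_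
  rw [sub_ne_zero]
  intro h
  exact (Finset.mem_Ioi.1 hj).ne (MvPowerSeries.X_inj.1 h)

lemma X_ne_zero {n : ℕ} (i : Fin n) : (MvPowerSeries.X i : MvPowerSeries (Fin n) k) ≠ 0 := by
  classical
  intro h
  have := congrArg (MvPowerSeries.coeff (Finsupp.single i 1)) h
  simp [MvPowerSeries.coeff_X] at this

/-- The bialternant formula. -/
lemma restrict_jt_mul (n : ℕ) (v : Fin n → Polynomial k) :
    restrict k n (jt k (completeSeries k) n v) * grothendieckDenominator k n =
      (Matrix.of fun i j : Fin n =>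
        Polynomial.aeval (MvPowerSeries.X i : MvPowerSeries (Fin n) k) (v j)).det := by
  rw [restrict_jt, grothendieckDenominator_eq]
  exact jt_mul_vandermonde _ _ (completeSeriesFin_mul k n) v

/-- At the extra variable `0` the last row becomes `(0, …, 0, 1)`, and in every other row a factor
`x_i` can be taken out. -/
lemma det_snoc_zero {n : ℕ} (w : Fin n → Polynomial k) (v : Fin (n + 1) → Polynomial k)
    (hv : ∀ i, v i.castSucc = Polynomial.X * w i) (y : Fin (n + 1) → MvPowerSeries (Fin n) k)
    (hy : y = Fin.snoc (α := fun _ => MvPowerSeries (Fin n) k) MvPowerSeries.X 0)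
    (h1 : (v (Fin.last n)).coeff 0 = 1) :
    (Matrix.of fun i j : Fin (n + 1) => Polynomial.aeval (y i) (v j)).det =
      (∏ i : Fin n, MvPowerSeries.X i) * (Matrix.of fun i j : Fin n =>
        Polynomial.aeval (MvPowerSeries.X i : MvPowerSeries (Fin n) k) (w j)).det := by
  rw [det_eq_of_last_row]
  · rw [← Matrix.det_mul_column]
    congr 1
    ext i j : 1
    simp [hy, hv]
  · intro j
    simp [hy, hv]
  · simp [hy, ← Polynomial.coeff_zero_eq_aeval_zero', h1]

/-- The restriction to `n` variables of a determinant of size `n + 1`. -/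
lemma restrict_jt_succ_mul (n : ℕ) (w : Fin n → Polynomial k) (v : Fin (n + 1) → Polynomial k)
    (hv : ∀ i, v i.castSucc = Polynomial.X * w i) (h1 : (v (Fin.last n)).coeff 0 = 1) :
    restrict k n (jt k (completeSeries k) (n + 1) v) * grothendieckDenominator k n =
      (Matrix.of fun i j : Fin n =>
        Polynomial.aeval (MvPowerSeries.X i : MvPowerSeries (Fin n) k) (w j)).det := by
  set y : Fin (n + 1) → MvPowerSeries (Fin n) k :=
    Fin.snoc (α := fun _ => MvPowerSeries (Fin n) k) MvPowerSeries.X 0 with hy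
  have h := jt_mul_vandermonde (k := k) (completeSeriesFin k n) y (by
    rw [Fin.prod_univ_castSucc]
    simpa [hy] using completeSeriesFin_mul k n) v
  -- The larger Vandermonde determinant acquires the same factor `∏ x_i` as the numerator, so it
  -- cancels.
  have hV := det_snoc_zero k (fun i : Fin n => Polynomial.X ^ (n - 1 - (i : ℕ)))
    (fun i : Fin (n + 1) => Polynomial.X ^ (n + 1 - 1 - (i : ℕ))) (fun i => by
      rw [← pow_succ']
      congr 1
      simp only [Fin.val_castSucc]
      omega) y hy (by simp)
  rw [det_snoc_zero k w v hv y hy h1] at h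
  simp only [map_pow, Polynomial.aeval_X] at hV
  rw [hV, ← grothendieckDenominator_eq, mul_left_comm] at h
  rw [restrict_jt]
  refine mul_left_cancel₀ (Finset.prod_ne_zero_iff.2 fun i _ => ?_) h
  exact X_ne_zero k i

/-- The restriction to `n` variables of a determinant of size `n + 1` divisible by all variables. -/
lemma restrict_jt_succ_eq_zero (n : ℕ) (v : Fin (n + 1) → Polynomial k)
    (hv : ∀ i, (v i).coeff 0 = 0) : restrict k n (jt k (completeSeries k) (n + 1) v) = 0 := by
  set y : Fin (n + 1) → MvPowerSeries (Fin n) k :=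
    Fin.snoc (α := fun _ => MvPowerSeries (Fin n) k) MvPowerSeries.X 0 with hy
  have h := jt_mul_vandermonde (k := k) (completeSeriesFin k n) y (by
    rw [Fin.prod_univ_castSucc]
    simpa [hy] using completeSeriesFin_mul k n) v
  have hV := det_snoc_zero k (fun i : Fin n => Polynomial.X ^ (n - 1 - (i : ℕ)))
    (fun i : Fin (n + 1) => Polynomial.X ^ (n + 1 - 1 - (i : ℕ))) (fun i => by
      rw [← pow_succ']
      congr 1
      simp only [Fin.val_castSucc]
      omega) y hy (by simp)
  simp only [map_pow, Polynomial.aeval_X] at hV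
  rw [hV, ← grothendieckDenominator_eq, Matrix.det_eq_zero_of_row_eq_zero (Fin.last n)] at h
  · rw [restrict_jt]
    refine (mul_eq_zero.1 h).resolve_right (mul_ne_zero ?_ (grothendieckDenominator_ne_zero k n))
    exact Finset.prod_ne_zero_iff.2 fun i _ => X_ne_zero k i
  · intro j
    simp [hy, ← Polynomial.coeff_zero_eq_aeval_zero', hv]

end Restrict

end StableGrothendieck
end

noncomputable section
namespace StableGrothendieck

/-! ## Partitions and strictly decreasing sequences -/

section Partitions

lemma rowLen_eq_zero {μ : YoungDiagram} {i : ℕ} (h : μ.colLen 0 ≤ i) : μ.rowLen i = 0 := by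
  by_contra h'
  have := YoungDiagram.mem_iff_lt_rowLen.2 (Nat.pos_of_ne_zero h')
  rw [YoungDiagram.mem_iff_lt_colLen] at this
  omega

lemma rowLen_pos {μ : YoungDiagram} {i : ℕ} (h : i < μ.colLen 0) : 0 < μ.rowLen i :=
  YoungDiagram.mem_iff_lt_rowLen.1 (YoungDiagram.mem_iff_lt_colLen.2 h)

lemma colLen_le_iff {μ : YoungDiagram} {n : ℕ} : μ.colLen 0 ≤ n ↔ μ.rowLen n = 0 := by
  refine ⟨rowLen_eq_zero, fun h => ?_⟩
  by_contra h'
  have := rowLen_pos (not_le.1 h')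
  omega

lemma ext_rowLen {μ ν : YoungDiagram} (h : ∀ i, μ.rowLen i = ν.rowLen i) : μ = ν := by
  refine SetLike.ext fun c => ?_
  rcases c with ⟨i, j⟩
  rw [YoungDiagram.mem_iff_lt_rowLen, YoungDiagram.mem_iff_lt_rowLen, h]

/-- The strictly decreasing sequence `μ_i + n - i`. -/
def partExp (μ : YoungDiagram) (n : ℕ) (i : Fin n) : ℕ := μ.rowLen i + (n - 1 - (i : ℕ))

lemma partExp_strictAnti (μ : YoungDiagram) (n : ℕ) : StrictAnti (partExp μ n) := by
  intro i j hij
  have := μ.rowLen_anti i j hij.le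
  have := j.2
  simp only [partExp]
  have : (i : ℕ) < j := hij
  omega

lemma partExp_injective {μ ν : YoungDiagram} {n : ℕ} (hμ : μ.colLen 0 ≤ n) (hν : ν.colLen 0 ≤ n)
    (h : partExp μ n = partExp ν n) : μ = ν := by
  refine ext_rowLen fun i => ?_
  by_cases hi : i < n
  · have := congrFun h ⟨i, hi⟩
    simpa [partExp] using this
  · rw [rowLen_eq_zero (by omega), rowLen_eq_zero (by omega)]

lemma add_le_of_strictAnti {n : ℕ} {d : Fin n → ℕ} (hd : StrictAnti d) (t : ℕ) (i j : Fin n)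
    (h : (j : ℕ) = i + t) : d j + t ≤ d i := by
  induction t generalizing j with
  | zero => simp [Fin.ext (h : (j : ℕ) = i)]
  | succ t ih =>
    have h1 := ih ⟨i + t, by omega⟩ rfl
    have h2 : d j < d ⟨i + t, by omega⟩ := hd (Fin.lt_def.2 (by simp only; omega))
    omega

lemma exists_partExp_eq {n : ℕ} {d : Fin n → ℕ} (hd : StrictAnti d) :
    ∃ μ : YoungDiagram, μ.colLen 0 ≤ n ∧ partExp μ n = d := by
  have hanti : Antitone fun i : Fin n => d i - (n - 1 - (i : ℕ)) := by
    intro i j hij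
    have hij' : (i : ℕ) ≤ j := hij
    have := add_le_of_strictAnti hd ((j : ℕ) - i) i j (by omega)
    have := j.2
    simp only
    omega
  have hs := hanti.sortedGE_ofFn
  refine ⟨YoungDiagram.ofRowLens _ hs, ?_, ?_⟩
  · rw [colLen_le_iff]
    by_contra h
    have h1 := YoungDiagram.mem_iff_lt_rowLen.2 (Nat.pos_of_ne_zero h)
    rw [YoungDiagram.mem_ofRowLens] at h1
    obtain ⟨h1, _⟩ := h1
    simp at h1
  · funext i
    have h1 := YoungDiagram.rowLen_ofRowLens (hw := hs) ⟨i, by simp⟩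
    simp only [Fin.getElem_fin, List.getElem_ofFn] at h1
    rw [partExp, h1]
    have := add_le_of_strictAnti hd (n - 1 - i) i ⟨n - 1, by have := i.2; omega⟩ (by
      have := i.2
      simp only
      omega)
    simp only [Fin.eta]
    omega

lemma exists_strictAnti_comp {n : ℕ} {d : Fin n → ℕ} (hd : Function.Injective d) :
    ∃ σ : Equiv.Perm (Fin n), StrictAnti (d ∘ σ) := by
  have h := Tuple.monotone_sort (OrderDual.toDual ∘ d)
  refine ⟨Tuple.sort (OrderDual.toDual ∘ d), ?_⟩
  refine Antitone.strictAnti_of_injective (fun i j hij => h hij) (hd.comp (Equiv.injective _))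

/-- Such a `σ` is an increasing bijection of `Fin n`. -/
lemma perm_eq_one_of_strictAnti {n : ℕ} {a b : Fin n → ℕ} (ha : StrictAnti a) (hb : StrictAnti b)
    {σ : Equiv.Perm (Fin n)} (h : ∀ i, a (σ i) = b i) : σ = 1 := by
  have hσ : StrictMono σ := fun i j hij => by
    rw [← ha.lt_iff_gt, h, h]
    exact hb hij
  have := Subsingleton.elim (hσ.orderIsoOfSurjective _ σ.surjective) (OrderIso.refl (Fin n))
  ext i
  have h2 := DFunLike.congr_fun this i
  simpa using congrArg Fin.val h2

end Partitions

/-! ### Schur functions form a basis -/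

section Schur

variable (k : Type*) [Field k]

lemma coeffInt_completeSeries (z : ℤ) : coeffInt z (completeSeries k) = completeSymInt k z := by
  unfold coeffInt completeSymInt completeSeries
  rw [PowerSeries.coeff_mk]

lemma completeSymInt_zero : completeSymInt k 0 = 1 := by
  simp [completeSymInt, completeSym_zero]

lemma completeSymInt_of_neg {z : ℤ} (h : z < 0) : completeSymInt k z = 0 := if_neg (not_le.2 h)

/-- A zero part appended to `μ` adds the last row `(0, …, 0, 1)`. -/
lemma schur_eq_det {μ : YoungDiagram} {n : ℕ} (h : μ.colLen 0 ≤ n) : schur k μ =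
    (Matrix.of fun i j : Fin n =>
      completeSymInt k ((μ.rowLen i : ℤ) - (i : ℤ) + (j : ℤ))).det := by
  induction n, h using Nat.le_induction with
  | base => rfl
  | succ n hn ih =>
    rw [ih, det_eq_of_last_row (n := n)]
    · rfl
    · intro j
      rw [Matrix.of_apply, completeSymInt_of_neg]
      simp only [Fin.val_last, rowLen_eq_zero hn, Fin.val_castSucc]
      have := j.2
      omega
    · rw [Matrix.of_apply, ← completeSymInt_zero]
      congr 1
      simp [rowLen_eq_zero hn]

lemma schur_eq_jt {μ : YoungDiagram} {n : ℕ} (h : μ.colLen 0 ≤ n) :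
    schur k μ = jt k (completeSeries k) n fun i => Polynomial.X ^ partExp μ n i := by
  rw [schur_eq_det k h, jt_apply]
  congr 1
  ext i j : 1
  rw [Matrix.of_apply, Matrix.of_apply, jtRow_X_pow, coeffInt_completeSeries]
  congr 1
  have := i.2
  simp only [partExp]
  omega

lemma restrict_eq_zero_of_le {m n : ℕ} (h : n ≤ m) {f : SymFun k} (hf : restrict k m f = 0) :
    restrict k n f = 0 := by
  ext d
  have h1 := congrArg (MvPowerSeries.coeff (d.mapDomain (Fin.castLE h))) hf
  rw [coeff_restrict, ← Finsupp.mapDomain_comp] at h1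
  rw [coeff_restrict]
  exact h1

/-- It suffices to restrict to `ℓ(μ) - 1` variables. In the bialternant of size `ℓ(μ)` all exponents
are positive, so setting the last variable to `0` produces a zero row. -/
lemma restrict_schur_eq_zero {μ : YoungDiagram} {n : ℕ} (h : n < μ.colLen 0) :
    restrict k n (schur k μ) = 0 := by
  obtain ⟨m, hm⟩ : ∃ m, μ.colLen 0 = m + 1 := ⟨μ.colLen 0 - 1, by omega⟩
  refine restrict_eq_zero_of_le k (m := m) (by omega) ?_
  rw [schur_eq_jt k hm.le]
  refine restrict_jt_succ_eq_zero k m _ fun i => ?_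
  have := rowLen_pos (μ := μ) (i := i) (by omega)
  rw [Polynomial.coeff_X_pow, if_neg]
  simp only [partExp]
  omega

/-- The alternant `det (x_i^{α_j})`. -/
def alternant {n : ℕ} (α : Fin n → ℕ) : MvPowerSeries (Fin n) k :=
  (Matrix.of fun i j : Fin n => (MvPowerSeries.X i : MvPowerSeries (Fin n) k) ^ α j).det

lemma coeff_alternant_eq_sum {n : ℕ} (α : Fin n → ℕ) (d : Fin n →₀ ℕ) :
    MvPowerSeries.coeff d (alternant k α) =
      ∑ σ : Equiv.Perm (Fin n), if ∀ i, d (σ i) = α i then ((σ.sign : ℤ) : k) else 0 := by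
  classical
  rw [alternant, Matrix.det_apply', map_sum]
  refine Finset.sum_congr rfl fun σ _ => ?_
  have h1 : ∏ i, (Matrix.of fun i j : Fin n =>
      (MvPowerSeries.X i : MvPowerSeries (Fin n) k) ^ α j) (σ i) i =
      MvPowerSeries.monomial (Finsupp.equivFunOnFinite.symm (α ∘ σ.symm)) 1 := by
    rw [← prod_X_pow_eq_monomial, ← Equiv.prod_comp σ (fun i => MvPowerSeries.X i ^ _)]
    simp
  have h2 : (((σ.sign : ℤ) : MvPowerSeries (Fin n) k)) = MvPowerSeries.C ((σ.sign : ℤ) : k) := by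
    simp
  rw [h1, h2, MvPowerSeries.coeff_C_mul, MvPowerSeries.coeff_monomial, mul_ite, mul_one, mul_zero]
  congr 1
  rw [eq_iff_iff]
  constructor
  · rintro rfl i
    simp
  · intro h
    ext i
    simpa using h (σ.symm i)

/-- Among the permuted exponents of an alternant, only the identity permutation gives a decreasing
sequence. Coefficients at decreasing exponents therefore separate Schur functions. -/
lemma coeff_alternant {n : ℕ} {α : Fin n → ℕ} (hα : StrictAnti α) {d : Fin n →₀ ℕ}
    (hd : StrictAnti d) : MvPowerSeries.coeff d (alternant k α) = if ⇑d = α then 1 else 0 := by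
  rw [coeff_alternant_eq_sum, Finset.sum_eq_single 1]
  · simp [funext_iff]
  · intro σ _ hσ
    exact if_neg fun h => hσ (perm_eq_one_of_strictAnti hd hα h)
  · simp

lemma grothendieckDenominator_eq_alternant (n : ℕ) : grothendieckDenominator k n =
    alternant k fun j : Fin n => n - 1 - (j : ℕ) := grothendieckDenominator_eq k n

lemma restrict_schur_mul {μ : YoungDiagram} {n : ℕ} (h : μ.colLen 0 ≤ n) :
    restrict k n (schur k μ) * grothendieckDenominator k n = alternant k (partExp μ n) := by
  rw [schur_eq_jt k h, restrict_jt_mul]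
  simp [alternant]

/-- The exponent `μ_i + n - i` as a finitely supported function. -/
def partFinsupp (μ : YoungDiagram) (n : ℕ) : Fin n →₀ ℕ := Finsupp.equivFunOnFinite.symm (partExp μ n)

@[simp] lemma coe_partFinsupp (μ : YoungDiagram) (n : ℕ) : ⇑(partFinsupp μ n) = partExp μ n := rfl

/-- The coefficient of `s_μ` read off from the restriction to `n ≥ ℓ(μ)` variables. -/
def schurCoeff (n : ℕ) (μ : YoungDiagram) : SymFun k →ₗ[k] k :=
  MvPowerSeries.coeff (partFinsupp μ n) ∘ₗ LinearMap.mulRight k (grothendieckDenominator k n) ∘ₗ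
    restrict k n

lemma schurCoeff_apply (n : ℕ) (μ : YoungDiagram) (f : SymFun k) : schurCoeff k n μ f =
    MvPowerSeries.coeff (partFinsupp μ n) (restrict k n f * grothendieckDenominator k n) := rfl

open Classical in
lemma schurCoeff_schur {n : ℕ} {μ : YoungDiagram} (hμ : μ.colLen 0 ≤ n) (ν : YoungDiagram) :
    schurCoeff k n μ (schur k ν) = if ν = μ then 1 else 0 := by
  rw [schurCoeff_apply]
  by_cases hν : ν.colLen 0 ≤ n
  · rw [restrict_schur_mul k hν, coeff_alternant k (partExp_strictAnti _ _)
      (by simpa using partExp_strictAnti μ n), coe_partFinsupp]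
    congr 1
    rw [eq_iff_iff]
    exact ⟨fun h => (partExp_injective hμ hν h).symm, fun h => by rw [h]⟩
  · rw [restrict_schur_eq_zero k (not_le.1 hν), zero_mul, map_zero, if_neg]
    rintro rfl
    exact hν hμ

lemma linearIndependent_schur : LinearIndependent k (schur k) := by
  classical
  rw [linearIndependent_iff']
  intro s g hg μ hμ
  have h := congrArg (schurCoeff k (μ.colLen 0) μ) hg
  simp only [map_sum, map_smul, schurCoeff_schur k le_rfl, map_zero, smul_eq_mul, mul_ite, mul_one,
    mul_zero] at h
  rwa [Finset.sum_ite_eq' s μ, if_pos hμ] at h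

/-! ### Antisymmetric power series -/

lemma rename_alternant {n : ℕ} (α : Fin n → ℕ) (σ : Equiv.Perm (Fin n)) :
    MvPowerSeries.rename σ (alternant k α) = ((σ.sign : ℤ) : k) • alternant k α := by
  rw [alternant, AlgHom.map_det]
  have : (MvPowerSeries.rename (R := k) σ).mapMatrix (Matrix.of fun i j : Fin n =>
      (MvPowerSeries.X i : MvPowerSeries (Fin n) k) ^ α j) = (Matrix.of fun i j : Fin n =>
      (MvPowerSeries.X i : MvPowerSeries (Fin n) k) ^ α j).submatrix σ id := by
    ext i j : 1
    simp
  rw [this, Matrix.det_permute, Algebra.smul_def]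
  congr 1
  simp

lemma exists_perm_nat {ι : Type*} [Finite ι] (x y : ι ↪ ℕ) :
    ∃ σ : Equiv.Perm ℕ, ∀ i, σ (x i) = y i := by
  obtain ⟨σ, h⟩ := Equiv.Perm.exists_smul_eq_embedding x y
  exact ⟨σ, fun i => DFunLike.congr_fun h i⟩

lemma coeff_equivMapDomain (f : SymFun k) (σ : Equiv.Perm ℕ) (d : ℕ →₀ ℕ) :
    MvPowerSeries.coeff (Finsupp.equivMapDomain σ d) f.1 = MvPowerSeries.coeff d f.1 := f.2.1 σ d

lemma coeff_embDomain_restrict {n : ℕ} (f : SymFun k) (σ : Equiv.Perm (Fin n)) (d : Fin n →₀ ℕ) :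
    MvPowerSeries.coeff (Finsupp.embDomain σ.toEmbedding d) (restrict k n f) =
      MvPowerSeries.coeff d (restrict k n f) := by
  obtain ⟨τ, hτ⟩ := exists_perm_nat (Fin.valEmbedding (n := n)) (σ.toEmbedding.trans Fin.valEmbedding)
  rw [coeff_restrict, coeff_restrict, ← coeff_equivMapDomain k f τ (d.mapDomain Fin.val)]
  congr 2
  rw [Finsupp.embDomain_eq_mapDomain, Finsupp.equivMapDomain_eq_mapDomain, ← Finsupp.mapDomain_comp,
    ← Finsupp.mapDomain_comp]
  congr 1
  funext i
  exact (hτ i).symm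

lemma rename_restrict {n : ℕ} (f : SymFun k) (σ : Equiv.Perm (Fin n)) :
    MvPowerSeries.rename σ (restrict k n f) = restrict k n f := by
  ext d
  obtain ⟨e, rfl⟩ : ∃ e, d = Finsupp.embDomain σ.toEmbedding e := by
    refine ⟨Finsupp.embDomain σ.symm.toEmbedding d, ?_⟩
    rw [Finsupp.embDomain_eq_mapDomain, Finsupp.embDomain_eq_mapDomain, ← Finsupp.mapDomain_comp]
    have : ((σ.toEmbedding : Fin n → Fin n) ∘ (σ.symm.toEmbedding : Fin n → Fin n)) = id := by
      funext i
      simp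
    rw [this, Finsupp.mapDomain_id]
  rw [coeff_embDomain_restrict]
  exact MvPowerSeries.coeff_embDomain_rename σ.toEmbedding _ _

/-- Distinct exponents can be sorted at the cost of a sign. If two exponents agree, swapping them
shows that the coefficient equals its own negative. -/
lemma eq_zero_of_antisymmetric [CharZero k] {n : ℕ} {p : MvPowerSeries (Fin n) k}
    (hp : ∀ σ : Equiv.Perm (Fin n), MvPowerSeries.rename σ p = ((σ.sign : ℤ) : k) • p)
    (h0 : ∀ d : Fin n →₀ ℕ, StrictAnti d → MvPowerSeries.coeff d p = 0) : p = 0 := by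
  have key : ∀ (σ : Equiv.Perm (Fin n)) (d : Fin n →₀ ℕ), MvPowerSeries.coeff d p =
      ((σ.sign : ℤ) : k) * MvPowerSeries.coeff (Finsupp.embDomain σ.toEmbedding d) p := by
    intro σ d
    rw [← MvPowerSeries.coeff_embDomain_rename σ.toEmbedding p d]
    change MvPowerSeries.coeff _ (MvPowerSeries.rename σ p) = _
    rw [hp, map_smul, smul_eq_mul]
  have hemb : ∀ (σ : Equiv.Perm (Fin n)) (d : Fin n →₀ ℕ) (i : Fin n),
      Finsupp.embDomain σ.toEmbedding d i = d (σ.symm i) := by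
    intro σ d i
    conv_lhs => rw [← σ.apply_symm_apply i]
    exact Finsupp.embDomain_apply_self σ.toEmbedding d (σ.symm i)
  ext d
  by_cases hd : Function.Injective d
  · obtain ⟨σ, hσ⟩ := exists_strictAnti_comp hd
    rw [key σ.symm d, h0, mul_zero, map_zero]
    convert hσ using 1
    funext i
    rw [hemb]
    rfl
  · rw [Function.Injective] at hd
    push Not at hd
    obtain ⟨i, j, hij, hne⟩ := hd
    have h := key (Equiv.swap i j) d
    have h2 : Finsupp.embDomain (Equiv.swap i j).toEmbedding d = d := by
      ext l
      rw [hemb, Equiv.symm_swap]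
      rcases eq_or_ne l i with rfl | hi
      · rw [Equiv.swap_apply_left, hij]
      · rcases eq_or_ne l j with rfl | hj
        · rw [Equiv.swap_apply_right, hij]
        · rw [Equiv.swap_apply_of_ne_of_ne hi hj]
    rw [h2, Equiv.Perm.sign_swap hne] at h
    simp only [Units.val_neg, Units.val_one, Int.cast_neg, Int.cast_one, neg_mul, one_mul] at h
    rw [map_zero]
    exact self_eq_neg.1 h

/-! ### Degrees -/

/-- The coefficients of `f` in degrees greater than `z` vanish. -/
def DegLE (z : ℤ) (f : SymFun k) : Prop :=
  ∀ d : ℕ →₀ ℕ, z < d.degree → MvPowerSeries.coeff d f.1 = 0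

/-- The symmetric functions of degree at most `z`. -/
def degLE (z : ℤ) : Submodule k (SymFun k) where
  carrier := {f | DegLE k z f}
  add_mem' {f g} hf hg d hd := by
    change MvPowerSeries.coeff d (f.1 + g.1) = 0
    rw [map_add, hf d hd, hg d hd, add_zero]
  zero_mem' d _ := MvPowerSeries.coeff_zero d
  smul_mem' c f hf d hd := by
    change MvPowerSeries.coeff d (c • f.1) = 0
    rw [map_smul, hf d hd, smul_zero]

lemma DegLE.mul {z w : ℤ} {f g : SymFun k} (hf : DegLE k z f) (hg : DegLE k w g) :
    DegLE k (z + w) (f * g) := by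
  classical
  intro d hd
  change MvPowerSeries.coeff d (f.1 * g.1) = 0
  rw [MvPowerSeries.coeff_mul]
  refine Finset.sum_eq_zero fun p hp => ?_
  rw [Finset.HasAntidiagonal.mem_antidiagonal] at hp
  have h : p.1.degree + p.2.degree = d.degree := by rw [← hp, map_add]
  rcases lt_or_ge z p.1.degree with h1 | h1
  · rw [hf _ h1, zero_mul]
  · rw [hg _ (by omega), mul_zero]

lemma DegLE.one : DegLE k 0 (1 : SymFun k) := by
  classical
  intro d hd
  change MvPowerSeries.coeff d (1 : MvPowerSeries ℕ k) = 0
  rw [MvPowerSeries.coeff_one, if_neg]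
  rintro rfl
  simp at hd

lemma DegLE.prod {ι : Type*} (s : Finset ι) (z : ι → ℤ) (f : ι → SymFun k)
    (h : ∀ i, DegLE k (z i) (f i)) : DegLE k (∑ i ∈ s, z i) (∏ i ∈ s, f i) := by
  classical
  induction s using Finset.induction_on with
  | empty => simpa using DegLE.one k
  | insert a s ha ih =>
    rw [Finset.sum_insert ha, Finset.prod_insert ha]
    exact (h a).mul k ih

lemma DegLE.completeSymInt (z : ℤ) : DegLE k z (completeSymInt k z) := by
  intro d hd
  unfold StableGrothendieck.completeSymInt
  split_ifs with h
  · rw [coeff_completeSym, if_neg]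
    omega
  · rfl

lemma schur_mem_degLE {μ : YoungDiagram} {n : ℕ} (h : μ.colLen 0 ≤ n) :
    schur k μ ∈ degLE k (∑ i : Fin n, (μ.rowLen i : ℤ)) := by
  rw [schur_eq_det k h, Matrix.det_apply]
  refine Submodule.sum_mem _ fun σ _ => ?_
  have h1 : DegLE k (∑ i : Fin n, ((μ.rowLen (σ i) : ℤ) - (σ i : ℤ) + (i : ℤ)))
      (∏ i, (Matrix.of fun i j : Fin n =>
        StableGrothendieck.completeSymInt k ((μ.rowLen i : ℤ) - (i : ℤ) + (j : ℤ))) (σ i) i) :=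
    DegLE.prod k _ _ _ fun i => DegLE.completeSymInt k _
  have h2 : ∑ i : Fin n, ((μ.rowLen (σ i) : ℤ) - (σ i : ℤ) + (i : ℤ)) =
      ∑ i : Fin n, (μ.rowLen i : ℤ) := by
    rw [Finset.sum_add_distrib, Finset.sum_sub_distrib,
      Equiv.sum_comp σ fun i : Fin n => (μ.rowLen i : ℤ), Equiv.sum_comp σ fun i : Fin n => (i : ℤ)]
    ring
  rw [h2] at h1
  rcases Int.units_eq_one_or σ.sign with hs | hs
  · rw [hs, one_smul]
    exact h1
  · rw [hs, Units.neg_smul, one_smul]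
    exact Submodule.neg_mem _ h1

/-- A symmetric function of degree at most `n` is determined by its restriction to `n` variables. -/
lemma eq_zero_of_restrict {n : ℕ} {f : SymFun k} (hf : f ∈ degLE k n) (h : restrict k n f = 0) :
    f = 0 := by
  classical
  refine SymFun.ext' k fun d => ?_
  change _ = MvPowerSeries.coeff d (0 : MvPowerSeries ℕ k)
  rw [map_zero]
  by_cases hd : (n : ℤ) < d.degree
  · exact hf d hd
  -- A monomial of degree at most `n` involves at most `n` variables, which a permutation moves
  -- among the first `n`.
  have hcard : d.support.card ≤ n := by
    have : d.support.card ≤ d.degree := by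
      rw [Finsupp.degree_apply, Finset.card_eq_sum_ones]
      exact Finset.sum_le_sum fun i hi => Nat.one_le_iff_ne_zero.2 (Finsupp.mem_support_iff.1 hi)
    omega
  let e := d.support.equivFin
  obtain ⟨σ, hσ⟩ := exists_perm_nat (Function.Embedding.subtype (· ∈ d.support))
    (e.toEmbedding.trans Fin.valEmbedding)
  rw [← coeff_equivMapDomain k f σ]
  set d' := Finsupp.equivMapDomain σ d with hd'
  have hsupp : ∀ i, d' i ≠ 0 → i < n := by
    intro i hi
    have h1 : σ.symm i ∈ d.support := by
      rw [Finsupp.mem_support_iff]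
      simpa [hd'] using hi
    have h2 := hσ ⟨_, h1⟩
    have h3 : i = (e ⟨_, h1⟩ : ℕ) := by simpa using h2
    rw [h3]
    exact lt_of_lt_of_le (e _).2 hcard
  have h1 := congrArg (MvPowerSeries.coeff (d'.comapDomain Fin.val Fin.val_injective.injOn)) h
  rw [coeff_restrict, Finsupp.mapDomain_comapDomain _ Fin.val_injective] at h1
  · exact h1
  · intro i hi
    exact ⟨⟨i, hsupp i (Finsupp.mem_support_iff.1 hi)⟩, rfl⟩

lemma exists_mem_degLE (f : SymFun k) : ∃ n : ℕ, f ∈ degLE k n := by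
  obtain ⟨N, hN⟩ := f.2.2
  exact ⟨N, fun d hd => hN d (by omega)⟩

lemma sum_partExp (μ : YoungDiagram) (n : ℕ) :
    ∑ i, partExp μ n i = ∑ i : Fin n, μ.rowLen i + ∑ i : Fin n, (n - 1 - (i : ℕ)) := by
  simp only [partExp, Finset.sum_add_distrib]

/-- The Schur functions span the symmetric functions. -/
lemma span_schur [CharZero k] : Submodule.span k (Set.range (schur k)) = ⊤ := by
  classical
  rw [Submodule.eq_top_iff']
  intro f
  obtain ⟨n, hn⟩ := exists_mem_degLE k f
  -- The coefficients of this antisymmetric series at decreasing exponents are the Schur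
  -- coefficients of `f`. As `n` bounds the degree of `f`, and `hdeg` then bounds the sizes of the
  -- occurring `μ`, no information is lost on restricting to `n` variables.
  set p := restrict k n f * grothendieckDenominator k n with hp
  have hdeg : ∀ d, MvPowerSeries.coeff d p ≠ 0 → d.degree ≤ n + ∑ i : Fin n, (n - 1 - (i : ℕ)) := by
    intro d hd
    by_contra hlt
    refine hd ?_
    rw [hp, MvPowerSeries.coeff_mul]
    refine Finset.sum_eq_zero fun q hq => ?_
    rw [Finset.HasAntidiagonal.mem_antidiagonal] at hq
    have hq' : q.1.degree + q.2.degree = d.degree := by rw [← hq, map_add]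
    by_cases h1 : n < q.1.degree
    · rw [coeff_restrict, hn _ (by rw [Finsupp.degree_mapDomain]; exact_mod_cast h1), zero_mul]
    · rw [grothendieckDenominator_eq_alternant, coeff_alternant_eq_sum, Finset.sum_eq_zero, mul_zero]
      intro σ _
      refine if_neg fun h => ?_
      have : q.2.degree = ∑ i : Fin n, (n - 1 - (i : ℕ)) := by
        rw [Finsupp.degree_eq_sum, ← Equiv.sum_comp σ]
        exact Finset.sum_congr rfl fun i _ => h i
      omega
  have hfin : {μ : YoungDiagram | μ.colLen 0 ≤ n ∧
      MvPowerSeries.coeff (partFinsupp μ n) p ≠ 0}.Finite := by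
    refine Set.Finite.of_finite_image (f := fun μ => partFinsupp μ n)
      ((Finsupp.finite_of_degree_le (n + ∑ i : Fin n, (n - 1 - (i : ℕ)))).subset ?_) ?_
    · rintro _ ⟨μ, hμ, rfl⟩
      exact hdeg _ hμ.2
    · intro μ hμ ν hν h
      exact partExp_injective hμ.1 hν.1 (DFunLike.coe_fn_eq.2 h)
  set g : SymFun k := ∑ μ ∈ hfin.toFinset, MvPowerSeries.coeff (partFinsupp μ n) p • schur k μ with hg
  have hgspan : g ∈ Submodule.span k (Set.range (schur k)) :=
    Submodule.sum_mem _ fun μ _ => Submodule.smul_mem _ _ (Submodule.subset_span ⟨μ, rfl⟩)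
  have hgdeg : g ∈ degLE k n := by
    refine Submodule.sum_mem _ fun μ hμ => Submodule.smul_mem _ _ ?_
    rw [Set.Finite.mem_toFinset] at hμ
    have h1 := hdeg _ hμ.2
    rw [Finsupp.degree_eq_sum, coe_partFinsupp, sum_partExp] at h1
    intro d hd
    refine schur_mem_degLE k hμ.1 d ?_
    refine lt_of_le_of_lt ?_ hd
    exact_mod_cast Nat.le_of_add_le_add_right h1
  suffices h : f - g = 0 by
    rw [sub_eq_zero.1 h]
    exact hgspan
  refine eq_zero_of_restrict k (Submodule.sub_mem _ hn hgdeg) ?_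
  refine (mul_eq_zero.1 ?_).resolve_right (grothendieckDenominator_ne_zero k n)
  refine eq_zero_of_antisymmetric k (fun σ => ?_) fun d hd => ?_
  · rw [map_mul, rename_restrict, grothendieckDenominator_eq_alternant, rename_alternant,
      mul_smul_comm]
  · obtain ⟨μ, hμ, hμd⟩ := exists_partExp_eq hd
    have hd' : d = partFinsupp μ n := DFunLike.coe_fn_eq.1 hμd.symm
    have h1 : MvPowerSeries.coeff d (restrict k n (f - g) * grothendieckDenominator k n) =
        schurCoeff k n μ (f - g) := by
      rw [schurCoeff_apply, hd']
    have h2 : schurCoeff k n μ f = MvPowerSeries.coeff (partFinsupp μ n) p := rfl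
    rw [h1, map_sub, h2, hg, map_sum]
    simp only [map_smul, schurCoeff_schur k hμ, smul_eq_mul, mul_ite, mul_one, mul_zero]
    rw [Finset.sum_ite_eq']
    by_cases h0 : MvPowerSeries.coeff (partFinsupp μ n) p = 0
    · simp [h0]
    · rw [if_pos (hfin.mem_toFinset.2 ⟨hμ, h0⟩), sub_self]

end Schur

end StableGrothendieck
end

noncomputable section
namespace StableGrothendieck

/-! ## The Hall pairing and the stable Grothendieck polynomials -/

section Hall

variable (k : Type*) [Field k]

lemma longPart_anti {m n : ℕ} (h : m ≤ n) : longPart k n ≤ longPart k m :=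
  Submodule.span_mono fun _ ⟨μ, h', e⟩ => ⟨μ, h.trans h', e⟩

lemma restrict_eq_zero_of_mem_longPart {n : ℕ} {u : SymFun k} (hu : u ∈ longPart k (n + 1)) :
    restrict k n u = 0 := by
  have : longPart k (n + 1) ≤ LinearMap.ker (restrict k n) := by
    refine Submodule.span_le.2 ?_
    rintro _ ⟨μ, hμ, rfl⟩
    exact restrict_schur_eq_zero k hμ
  exact this hu

lemma component_eq_of_le {F : CompletedSymFun k} {m n : ℕ} (h : m ≤ n) {u : SymFun k}
    (hu : F.1 n = (longPart k n).mkQ u) : F.1 m = (longPart k m).mkQ u := by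
  induction n, h using Nat.le_induction with
  | base => exact hu
  | succ n _ ih =>
    refine ih ?_
    rw [← F.2 n, hu]
    rfl

lemma toCompleted_component (u : SymFun k) (n : ℕ) :
    (toCompleted k u).1 n = (longPart k n).mkQ u := rfl

lemma exists_component_eq (F : CompletedSymFun k) (n : ℕ) : ∃ u, F.1 n = (longPart k n).mkQ u := by
  obtain ⟨u, hu⟩ := (longPart k n).mkQ_surjective (F.1 n)
  exact ⟨u, hu.symm⟩

variable [CharZero k]

/-- The basis of Schur functions. -/
def schurBasis : Module.Basis YoungDiagram k (SymFun k) :=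
  Module.Basis.mk (linearIndependent_schur k) (span_schur k).ge

@[simp] lemma schurBasis_apply (μ : YoungDiagram) : schurBasis k μ = schur k μ :=
  Module.Basis.mk_apply _ _ μ

open Classical in
lemma coord_schur (μ ν : YoungDiagram) :
    (schurBasis k).coord μ (schur k ν) = if ν = μ then 1 else 0 := by
  rw [← schurBasis_apply, Module.Basis.coord_apply, Module.Basis.repr_self, Finsupp.single_apply]

lemma schurCoeff_eq_coord {n : ℕ} {μ : YoungDiagram} (h : μ.colLen 0 ≤ n) :
    schurCoeff k n μ = (schurBasis k).coord μ := by
  classical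
  refine (schurBasis k).ext fun ν => ?_
  rw [schurBasis_apply, coord_schur, schurCoeff_schur k h]

lemma coord_eq_zero_of_mem_longPart {n : ℕ} {μ : YoungDiagram} (h : μ.colLen 0 < n) {u : SymFun k}
    (hu : u ∈ longPart k n) : (schurBasis k).coord μ u = 0 := by
  classical
  have : longPart k n ≤ LinearMap.ker ((schurBasis k).coord μ) := by
    refine Submodule.span_le.2 ?_
    rintro _ ⟨ν, hν, rfl⟩
    rw [SetLike.mem_coe, LinearMap.mem_ker, coord_schur, if_neg]
    rintro rfl
    omega
  exact this hu

/-- The coefficients at `s_μ` with `ℓ(μ) ≤ n` can be read off from the restriction. Together with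
`restrict_eq_zero_of_mem_longPart`, this identifies `M_{n+1}` with the kernel of restriction. -/
lemma mem_longPart_of_restrict {n : ℕ} {u : SymFun k} (hu : restrict k n u = 0) :
    u ∈ longPart k (n + 1) := by
  rw [← (schurBasis k).linearCombination_repr u, Finsupp.linearCombination_apply]
  refine Submodule.sum_mem _ fun μ hμ => Submodule.smul_mem _ _ (Submodule.subset_span ⟨μ, ?_, by simp⟩)
  by_contra h
  refine Finsupp.mem_support_iff.1 hμ ?_
  rw [← Module.Basis.coord_apply, ← schurCoeff_eq_coord k (n := n) (by omega), schurCoeff_apply, hu,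
    zero_mul, map_zero]

/-- By continuity `F` may be replaced by a lift `w` of a deep enough component, and on `Λ`
orthonormality determines the form. The lifts `w` and `u` differ by an element of `M_n`, which has
no `s_ν` term. -/
lemma IsHallPairing.apply_schur {B : CompletedSymFun k →ₗ[k] SymFun k →ₗ[k] k}
    (hB : IsHallPairing k B) {F : CompletedSymFun k} {ν : YoungDiagram} {n : ℕ} (hν : ν.colLen 0 < n)
    {u : SymFun k} (hu : F.1 n = (longPart k n).mkQ u) :
    B F (schur k ν) = (schurBasis k).coord ν u := by
  classical
  obtain ⟨N, hN⟩ := hB.2 (schur k ν)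
  obtain ⟨w, hw⟩ := exists_component_eq k F (max n N)
  have h1 : B F (schur k ν) = B (toCompleted k w) (schur k ν) := by
    obtain ⟨D, hD⟩ : ∃ D, F = D + toCompleted k w := 
      ⟨F - toCompleted k w, Subtype.ext (funext fun m => (sub_add_cancel (F.1 m) _).symm)⟩
    have hDN : D.1 N = 0 := by
      have h := component_eq_of_le k (le_max_right n N) hw
      rw [hD] at h
      change D.1 N + (longPart k N).mkQ w = _ at h
      exact add_eq_right.1 h
    rw [hD, map_add, LinearMap.add_apply, hN D hDN, zero_add]
  have h2 : (B ∘ₗ toCompleted k).flip (schur k ν) = (schurBasis k).coord ν := by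
    refine (schurBasis k).ext fun μ => ?_
    rw [schurBasis_apply, coord_schur]
    exact hB.1 μ ν
  have h3 : B (toCompleted k w) (schur k ν) = (schurBasis k).coord ν w := LinearMap.congr_fun h2 w
  have h4 : w - u ∈ longPart k n := by
    rw [← Submodule.Quotient.eq]
    exact (component_eq_of_le k (le_max_left n N) hw).symm.trans hu
  have h5 := coord_eq_zero_of_mem_longPart k hν h4
  rw [map_sub, sub_eq_zero] at h5
  rw [h1, h3, h5]

/-- The extended Hall inner product, constructed from the basis of Schur functions. -/
def hallForm : CompletedSymFun k →ₗ[k] SymFun k →ₗ[k] k :=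
  ((schurBasis k).constr k fun ν =>
    (Submodule.liftQ (longPart k (ν.colLen 0 + 1)) ((schurBasis k).coord ν) fun _ hu =>
      LinearMap.mem_ker.2 (coord_eq_zero_of_mem_longPart k (Nat.lt_succ_self _) hu)) ∘ₗ
    LinearMap.proj (ν.colLen 0 + 1) ∘ₗ (CompletedSymFun k).subtype).flip

lemma hallForm_schur (F : CompletedSymFun k) {ν : YoungDiagram} {n : ℕ} (hν : ν.colLen 0 < n)
    {u : SymFun k} (hu : F.1 n = (longPart k n).mkQ u) :
    hallForm k F (schur k ν) = (schurBasis k).coord ν u := by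
  rw [← schurBasis_apply, hallForm, LinearMap.flip_apply, Module.Basis.constr_basis]
  have h : F.1 (ν.colLen 0 + 1) = (longPart k (ν.colLen 0 + 1)).mkQ u := component_eq_of_le k hν hu
  simp only [LinearMap.comp_apply, LinearMap.proj_apply, Submodule.subtype_apply]
  rw [h, Submodule.mkQ_apply, Submodule.liftQ_apply]

lemma exists_colLen_lt (f : SymFun k) :
    ∃ n : ℕ, ∀ ν ∈ ((schurBasis k).repr f).support, ν.colLen 0 < n :=
  ⟨((schurBasis k).repr f).support.sup (fun ν => ν.colLen 0) + 1, fun _ hν =>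
    Nat.lt_succ_of_le (Finset.le_sup (f := fun ν : YoungDiagram => ν.colLen 0) hν)⟩

lemma isHallPairing_hallForm : IsHallPairing k (hallForm k) := by
  classical
  refine ⟨fun μ ν => ?_, fun f => ?_⟩
  · rw [hallForm_schur k _ (Nat.lt_succ_self _) (toCompleted_component k _ _), coord_schur]
  · obtain ⟨n, hn⟩ := exists_colLen_lt k f
    refine ⟨n, fun F hF => ?_⟩
    rw [← (schurBasis k).linearCombination_repr f, Finsupp.linearCombination_apply, Finsupp.sum,
      map_sum]
    refine Finset.sum_eq_zero fun ν hν => ?_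
    rw [map_smul, schurBasis_apply, hallForm_schur k F (hn ν hν) (u := 0) (by rw [hF, map_zero]),
      map_zero, smul_zero]

lemma existsUnique_isHallPairing : ∃! B, IsHallPairing k B := by
  refine ⟨hallForm k, isHallPairing_hallForm k, fun B hB => ?_⟩
  refine LinearMap.ext fun F => (schurBasis k).ext fun ν => ?_
  obtain ⟨u, hu⟩ := exists_component_eq k F (ν.colLen 0 + 1)
  rw [schurBasis_apply, hB.apply_schur k (Nat.lt_succ_self _) hu,
    hallForm_schur k F (Nat.lt_succ_self _) hu]

lemma isHallPairing_hallPairing : IsHallPairing k (hallPairing k) :=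
  Classical.epsilon_spec (existsUnique_isHallPairing k).exists

/-- The Hall inner product on symmetric functions. -/
def hallInner : SymFun k →ₗ[k] SymFun k →ₗ[k] k := (schurBasis k).constr k (schurBasis k).coord

lemma hallInner_schur_left (μ : YoungDiagram) (f : SymFun k) :
    hallInner k (schur k μ) f = (schurBasis k).coord μ f := by
  rw [← schurBasis_apply, hallInner, Module.Basis.constr_basis]

lemma hallInner_schur_right (ν : YoungDiagram) (u : SymFun k) :
    hallInner k u (schur k ν) = (schurBasis k).coord ν u := by
  classical
  have : (hallInner k).flip (schur k ν) = (schurBasis k).coord ν := by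
    refine (schurBasis k).ext fun μ => ?_
    rw [LinearMap.flip_apply, schurBasis_apply, hallInner_schur_left, coord_schur, coord_schur]
    simp only [eq_comm]
  exact LinearMap.congr_fun this u

/-- The span of the Schur functions `s_ν` with `ℓ(ν) ≤ n`. -/
def shortPart (n : ℕ) : Submodule k (SymFun k) :=
  Submodule.span k {f | ∃ ν : YoungDiagram, ν.colLen 0 ≤ n ∧ f = schur k ν}

/-- Pairing with Schur functions of length at most `n` sees `F` only modulo `M_{n+1}`, so
computations can be done in `Λ`. -/
lemma hallPairing_eq_hallInner {F : CompletedSymFun k} {n : ℕ} {u : SymFun k}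
    (hu : F.1 (n + 1) = (longPart k (n + 1)).mkQ u) {f : SymFun k} (hf : f ∈ shortPart k n) :
    hallPairing k F f = hallInner k u f := by
  have : shortPart k n ≤ LinearMap.eqLocus (hallPairing k F) (hallInner k u) := by
    refine Submodule.span_le.2 ?_
    rintro _ ⟨ν, hν, rfl⟩
    rw [SetLike.mem_coe, LinearMap.mem_eqLocus, hallInner_schur_right,
      (isHallPairing_hallPairing k).apply_schur k (Nat.lt_succ_of_le hν) hu]
  exact this hf

end Hall

/-! ### The Hall inner product of determinants -/

section Pairing

variable (k : Type*) [Field k]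

/-- Alternating maps on polynomials that agree on strictly decreasing families of monomials. -/
lemma alternating_ext {n : ℕ} {M : Type*} [AddCommGroup M] [Module k M]
    {f g : Polynomial k [⋀^Fin n]→ₗ[k] M} (h : ∀ d : Fin n → ℕ, StrictAnti d →
      (f fun i => Polynomial.X ^ d i) = g fun i => Polynomial.X ^ d i) : f = g := by
  refine (Polynomial.basisMonomials k).ext_alternating fun d hd => ?_
  obtain ⟨σ, hσ⟩ := exists_strictAnti_comp hd
  have h1 := h _ hσ
  have h2 : (fun i => (Polynomial.X : Polynomial k) ^ (d ∘ σ) i) =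
      (fun i => Polynomial.basisMonomials k (d i)) ∘ σ := by
    funext i
    simp only [Function.comp_apply, basisMonomials_eq_X_pow]
  rw [h2, AlternatingMap.map_perm, AlternatingMap.map_perm] at h1
  exact smul_left_cancel _ h1

lemma jt_mem_shortPart {n : ℕ} (v : Fin n → Polynomial k) :
    jt k (completeSeries k) n v ∈ shortPart k n := by
  have : (shortPart k n).mkQ.compAlternatingMap (jt k (completeSeries k) n) = 0 := by
    refine alternating_ext k fun d hd => ?_
    obtain ⟨μ, hμ, rfl⟩ := exists_partExp_eq hd
    rw [LinearMap.compAlternatingMap_apply, ← schur_eq_jt k hμ, AlternatingMap.zero_apply,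
      Submodule.mkQ_apply, Submodule.Quotient.mk_eq_zero]
    exact Submodule.subset_span ⟨μ, hμ, rfl⟩
  have h := DFunLike.congr_fun this v
  rwa [LinearMap.compAlternatingMap_apply, AlternatingMap.zero_apply, Submodule.mkQ_apply,
    Submodule.Quotient.mk_eq_zero] at h

/-- The bilinear form on polynomials for which the monomials are orthonormal. -/
def polyPair : Polynomial k →ₗ[k] Polynomial k →ₗ[k] k :=
  (Polynomial.basisMonomials k).constr k fun a => Polynomial.lcoeff k a

lemma polyPair_X_pow_left (a : ℕ) (w : Polynomial k) :
    polyPair k (Polynomial.X ^ a) w = w.coeff a := by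
  rw [← basisMonomials_eq_X_pow, polyPair, Module.Basis.constr_basis, Polynomial.lcoeff_apply]

lemma polyPair_X_pow_right (a : ℕ) (v : Polynomial k) :
    polyPair k v (Polynomial.X ^ a) = v.coeff a := by
  have : (polyPair k).flip (Polynomial.X ^ a) = Polynomial.lcoeff k a := by
    refine (Polynomial.basisMonomials k).ext fun b => ?_
    rw [basisMonomials_eq_X_pow, LinearMap.flip_apply, polyPair_X_pow_left, Polynomial.lcoeff_apply,
      Polynomial.coeff_X_pow, Polynomial.coeff_X_pow]
    simp only [eq_comm]
  exact LinearMap.congr_fun this v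

/-- The Hall inner product of two determinants. -/
lemma hallInner_jt [CharZero k] {n : ℕ} (v w : Fin n → Polynomial k) :
    hallInner k (jt k (completeSeries k) n v) (jt k (completeSeries k) n w) =
      (Matrix.of fun i j : Fin n => polyPair k (v i) (w j)).det := by
  classical
  -- Both sides are alternating in `v` and in `w`. On decreasing families of monomials the claim is
  -- the orthonormality of Schur functions, the right side being a determinant of Kronecker deltas.
  have h1 : ((hallInner k).flip (jt k (completeSeries k) n w)).compAlternatingMap
      (jt k (completeSeries k) n) = (Matrix.detRowAlternating (n := Fin n) (R := k)).compLinearMap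
        (LinearMap.pi fun j => (polyPair k).flip (w j)) := by
    refine alternating_ext k fun d hd => ?_
    obtain ⟨μ, hμ, rfl⟩ := exists_partExp_eq hd
    rw [LinearMap.compAlternatingMap_apply, ← schur_eq_jt k hμ, LinearMap.flip_apply,
      hallInner_schur_left]
    have h2 : ((schurBasis k).coord μ).compAlternatingMap (jt k (completeSeries k) n) =
        (Matrix.detRowAlternating (n := Fin n) (R := k)).compLinearMap
          (LinearMap.pi fun i => Polynomial.lcoeff k (partExp μ n i)) := by
      refine alternating_ext k fun d hd => ?_
      obtain ⟨ν, hν, rfl⟩ := exists_partExp_eq hd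
      rw [LinearMap.compAlternatingMap_apply, ← schur_eq_jt k hν, coord_schur]
      change _ = Matrix.det (Matrix.of fun i j : Fin n =>
        ((Polynomial.X : Polynomial k) ^ partExp ν n i).coeff (partExp μ n j))
      rw [Matrix.det_apply', Finset.sum_eq_single 1]
      · simp only [Equiv.Perm.sign_one, Units.val_one, Int.cast_one, one_mul, Equiv.Perm.one_apply,
          Matrix.of_apply, Polynomial.coeff_X_pow]
        rw [Finset.prod_ite_zero, Finset.prod_const_one]
        congr 1
        rw [eq_iff_iff]
        refine ⟨fun h i _ => by rw [h], fun h => partExp_injective hν hμ ?_⟩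
        funext i
        exact (h i (Finset.mem_univ i)).symm
      · intro σ _ hσ
        simp only [Matrix.of_apply, Polynomial.coeff_X_pow]
        rw [Finset.prod_ite_zero, if_neg, mul_zero]
        intro h
        exact hσ (perm_eq_one_of_strictAnti (partExp_strictAnti ν n) (partExp_strictAnti μ n)
          fun i => (h i (Finset.mem_univ i)).symm)
      · simp
    have h3 := DFunLike.congr_fun h2 w
    rw [LinearMap.compAlternatingMap_apply] at h3
    rw [h3]
    change Matrix.det (Matrix.of fun i j : Fin n => (w i).coeff (partExp μ n j)) =
      Matrix.det (Matrix.of fun i j : Fin n =>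
        polyPair k ((Polynomial.X : Polynomial k) ^ partExp μ n i) (w j))
    rw [← Matrix.det_transpose]
    congr 1
    ext i j : 1
    rw [Matrix.transpose_apply, Matrix.of_apply, Matrix.of_apply, polyPair_X_pow_left]
  exact DFunLike.congr_fun h1 v

end Pairing

/-! ### Construction of the stable Grothendieck polynomials -/

section Grothendieck

variable (k : Type*) [Field k] (β : k)

/-- The polynomials `x^{μ_i + n - i} (1 + β x)^{i - 1}`. -/
def grothPoly (μ : YoungDiagram) (n : ℕ) (i : Fin n) : Polynomial k :=
  Polynomial.X ^ partExp μ n i * (1 + Polynomial.C β * Polynomial.X) ^ (i : ℕ)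

/-- A representative of the stable Grothendieck polynomial modulo `M_{n+1}`. -/
def grothLift (μ : YoungDiagram) (n : ℕ) : SymFun k :=
  jt k (completeSeries k) n (grothPoly k β μ n)

lemma grothendieckNumerator_eq (μ : YoungDiagram) (n : ℕ) : grothendieckNumerator k β μ n =
    (Matrix.of fun i j : Fin n => Polynomial.aeval (MvPowerSeries.X i : MvPowerSeries (Fin n) k)
      (grothPoly k β μ n j)).det := by
  rw [grothendieckNumerator]
  congr 1
  ext i j : 1
  simp [grothPoly, partExp, MvPowerSeries.algebraMap_apply]

lemma restrict_grothLift_mul (μ : YoungDiagram) (n : ℕ) :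
    restrict k n (grothLift k β μ n) * grothendieckDenominator k n =
      grothendieckNumerator k β μ n := by
  rw [grothLift, restrict_jt_mul, grothendieckNumerator_eq]

/-- Stability: passing from `n` to `n + 1` multiplies the first `n` polynomials by `x`, and the new
last one is `(1 + β x)^n`, with constant term 1. -/
lemma restrict_grothLift_succ_mul {μ : YoungDiagram} {n : ℕ} (h : μ.colLen 0 ≤ n) :
    restrict k n (grothLift k β μ (n + 1)) * grothendieckDenominator k n =
      grothendieckNumerator k β μ n := by
  rw [grothLift, restrict_jt_succ_mul k n (grothPoly k β μ n), grothendieckNumerator_eq]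
  · intro i
    rw [grothPoly, grothPoly, ← mul_assoc, ← pow_succ']
    congr 2
    have := i.2
    simp only [partExp, Fin.val_castSucc]
    omega
  · simp [grothPoly, partExp, rowLen_eq_zero h, Polynomial.coeff_zero_eq_eval_zero]

variable [CharZero k]

/-- Consecutive lifts have the same restriction, so the lifts form a compatible system in the
completion. -/
lemma grothLift_sub_mem {μ : YoungDiagram} {m n : ℕ} (h : μ.colLen 0 ≤ m) (hmn : m ≤ n) :
    grothLift k β μ n - grothLift k β μ m ∈ longPart k (m + 1) := by
  induction n, hmn using Nat.le_induction with
  | base => rw [sub_self]; exact Submodule.zero_mem _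
  | succ n hn ih =>
    rw [← sub_add_sub_cancel _ (grothLift k β μ n)]
    refine Submodule.add_mem _ (longPart_anti k (by omega : m + 1 ≤ n + 1)
      (mem_longPart_of_restrict k ?_)) ih
    rw [map_sub, sub_eq_zero]
    refine mul_right_cancel₀ (grothendieckDenominator_ne_zero k n) ?_
    rw [restrict_grothLift_succ_mul k β (h.trans hn), restrict_grothLift_mul]

lemma IsStableGrothendieck.component {μ : YoungDiagram} {G : CompletedSymFun k}
    (hG : IsStableGrothendieck k β μ G) {n : ℕ} (h : μ.colLen 0 ≤ n) :
    G.1 (n + 1) = (longPart k (n + 1)).mkQ (grothLift k β μ n) := by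
  obtain ⟨u, hu⟩ := exists_component_eq k G (n + 1)
  rw [hu, Submodule.mkQ_apply, Submodule.mkQ_apply, Submodule.Quotient.eq]
  refine mem_longPart_of_restrict k ?_
  rw [map_sub, sub_eq_zero]
  refine mul_right_cancel₀ (grothendieckDenominator_ne_zero k n) ?_
  rw [hG n h u hu.symm, restrict_grothLift_mul]

lemma existsUnique_isStableGrothendieck (μ : YoungDiagram) :
    ∃! G, IsStableGrothendieck k β μ G := by
  -- The shift by `ℓ(μ)` keeps the size of the determinant at least `ℓ(μ)` also for small `m`.
  let G : CompletedSymFun k :=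
    ⟨fun m => (longPart k m).mkQ (grothLift k β μ (m + μ.colLen 0)), fun m => by
      change (longPart k m).mkQ (grothLift k β μ (m + 1 + μ.colLen 0)) =
        (longPart k m).mkQ (grothLift k β μ (m + μ.colLen 0))
      rw [Submodule.mkQ_apply, Submodule.mkQ_apply, Submodule.Quotient.eq]
      exact longPart_anti k (by omega)
        (grothLift_sub_mem k β (Nat.le_add_left _ m) (by omega : m + μ.colLen 0 ≤ _))⟩
  have hG : IsStableGrothendieck k β μ G := by
    intro n hn u hu
    change (longPart k (n + 1)).mkQ u =
      (longPart k (n + 1)).mkQ (grothLift k β μ (n + 1 + μ.colLen 0)) at hu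
    rw [Submodule.mkQ_apply, Submodule.mkQ_apply, Submodule.Quotient.eq] at hu
    have h1 := Submodule.add_mem _ hu (grothLift_sub_mem k β hn (by omega : n ≤ n + 1 + μ.colLen 0))
    rw [sub_add_sub_cancel] at h1
    have h2 := restrict_eq_zero_of_mem_longPart k h1
    rw [map_sub, sub_eq_zero] at h2
    rw [h2, restrict_grothLift_mul]
  refine ⟨G, hG, fun F hF => Subtype.ext (funext fun m => ?_)⟩
  have h : m ≤ m + μ.colLen 0 + 1 := by omega
  rw [component_eq_of_le k h (IsStableGrothendieck.component k β hF (Nat.le_add_left _ _)),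
    component_eq_of_le k h (IsStableGrothendieck.component k β hG (Nat.le_add_left _ _))]

lemma isStableGrothendieck_stableGrothendieck (μ : YoungDiagram) :
    IsStableGrothendieck k β μ (stableGrothendieck k β μ) :=
  Classical.epsilon_spec (existsUnique_isStableGrothendieck k β μ).exists

lemma hallPairing_stableGrothendieck {μ : YoungDiagram} {n : ℕ} (h : μ.colLen 0 ≤ n) {f : SymFun k}
    (hf : f ∈ shortPart k n) : hallPairing k (stableGrothendieck k β μ) f =
      hallInner k (grothLift k β μ n) f :=
  hallPairing_eq_hallInner k
    ((isStableGrothendieck_stableGrothendieck k β μ).component k β h) hf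

end Grothendieck

end StableGrothendieck
end

noncomputable section
namespace StableGrothendieck

/-! ## Duality -/

section Duality

variable (k : Type*) [Field k] (β : k)

/-- The polynomial part of `x^{μ_i + n - i} (1 + β / x)^{1 - i}`. -/
def dualPoly (μ : YoungDiagram) (n : ℕ) (i : Fin n) : Polynomial k :=
  ∑ m ∈ Finset.range (partExp μ n i + 1),
    PowerSeries.coeff m (invOneAdd k β ^ (i : ℕ)) • Polynomial.X ^ (partExp μ n i - m)

lemma coeffInt_mul_eq_sum {K : Type*} [CommRing K] (H Q : PowerSeries K) {z : ℤ} {N : ℕ}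
    (h : z < N) : coeffInt z (H * Q) =
      ∑ m ∈ Finset.range N, coeffInt (z - m) H * PowerSeries.coeff m Q := by
  by_cases hz : 0 ≤ z
  · obtain ⟨a, rfl⟩ := Int.eq_ofNat_of_zero_le hz
    rw [coeffInt_natCast, mul_comm, PowerSeries.coeff_mul,
      Finset.Nat.sum_antidiagonal_eq_sum_range_succ
        (fun i j => PowerSeries.coeff i Q * PowerSeries.coeff j H)]
    refine (Finset.sum_congr rfl fun m hm => ?_).trans
      (Finset.sum_subset (Finset.range_mono (by omega : a.succ ≤ N)) fun m _ hm => ?_)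
    · rw [Finset.mem_range] at hm
      have : (a : ℤ) - (m : ℤ) = ((a - m : ℕ) : ℤ) := by omega
      rw [this, coeffInt_natCast, mul_comm]
    · rw [Finset.mem_range] at hm
      rw [coeffInt_of_neg (by omega), zero_mul]
  · rw [coeffInt_of_neg (not_le.1 hz)]
    symm
    refine Finset.sum_eq_zero fun m _ => ?_
    rw [coeffInt_of_neg (by omega), zero_mul]

/-- Dropping the negative powers of `x` is harmless: they would contribute only `h` with negative
index. -/
lemma jtRow_dualPoly (μ : YoungDiagram) (n : ℕ) (i j : Fin n) :
    jtRow k (completeSeries k) n (dualPoly k β μ n i) j =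
      coeffInt ((μ.rowLen i : ℤ) - (i : ℤ) + (j : ℤ)) (completeSeries k *
        PowerSeries.map (algebraMap k (SymFun k)) (invOneAdd k β) ^ (i : ℕ)) := by
  have hi := i.2
  have hj := j.2
  rw [coeffInt_mul_eq_sum (N := partExp μ n i + 1), dualPoly, map_sum, Finset.sum_apply]
  · refine Finset.sum_congr rfl fun m hm => ?_
    rw [Finset.mem_range] at hm
    rw [map_smul, Pi.smul_apply, jtRow_X_pow, ← map_pow, PowerSeries.coeff_map, Algebra.smul_def,
      mul_comm]
    congr 2
    simp only [partExp] at hm ⊢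
    omega
  · simp only [partExp]
    omega

variable [CharZero k]

lemma dualGrothendieck_eq_jt (μ : YoungDiagram) (n : ℕ) :
    dualGrothendieck k β μ n = jt k (completeSeries k) n (dualPoly k β μ n) := by
  rw [dualGrothendieck_eq_det, jt_apply]
  congr 1
  ext i j : 1
  rw [Matrix.of_apply, Matrix.of_apply, jtRow_dualPoly]

/-- A further zero part adds the last row `(0, …, 0, 1)`, because the series in that row has
constant term 1. -/
lemma dualGrothendieck_of_le {μ : YoungDiagram} {r n : ℕ} (h : μ.colLen 0 ≤ r) (hrn : r ≤ n) :
    dualGrothendieck k β μ n = dualGrothendieck k β μ r := by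
  induction n, hrn using Nat.le_induction with
  | base => rfl
  | succ n hn ih =>
    rw [← ih, dualGrothendieck_eq_det, dualGrothendieck_eq_det, det_eq_of_last_row]
    · rfl
    · intro j
      have := j.2
      rw [Matrix.of_apply, coeffInt_of_neg]
      simp only [Fin.val_last, rowLen_eq_zero (h.trans hn), Fin.val_castSucc]
      omega
    · rw [Matrix.of_apply]
      simp only [Fin.val_last, rowLen_eq_zero (h.trans hn), Nat.cast_zero, zero_sub,
        neg_add_cancel]
      rw [← Nat.cast_zero, coeffInt_natCast, PowerSeries.coeff_zero_eq_constantCoeff_apply, map_mul,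
        map_pow, ← PowerSeries.coeff_zero_eq_constantCoeff_apply,
        ← PowerSeries.coeff_zero_eq_constantCoeff_apply, PowerSeries.coeff_map, completeSeries,
        invOneAdd, PowerSeries.coeff_mk, PowerSeries.coeff_mk, completeSym_zero]
      simp

end Duality

/-! ### Evaluation of the pairing determinant, and nondegeneracy -/

section Matrix

variable (k : Type*) [Field k] (β : k)

/-- The coefficient of `z^b` in `z^a (1 + β z)^{i - j}`. -/
def pairEntry (a b i j : ℕ) : k := PowerSeries.coeff b (PowerSeries.X ^ a *
  ((1 + PowerSeries.C β * PowerSeries.X) ^ i * invOneAdd k β ^ j))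

/-- For `polyPair`, multiplication by `x` is adjoint to division by `x` with truncation. The factor
`(1 + β / x)^{-j}` thus moves to the other side as `(1 + β x)^{-j}`. -/
lemma polyPair_grothPoly_dualPoly (μ ν : YoungDiagram) (n : ℕ) (i j : Fin n) :
    polyPair k (grothPoly k β μ n i) (dualPoly k β ν n j) =
      pairEntry k β (partExp μ n i) (partExp ν n j) i j := by
  rw [pairEntry, ← mul_assoc, mul_comm, PowerSeries.coeff_mul,
    Finset.Nat.sum_antidiagonal_eq_sum_range_succ (fun s t =>
      PowerSeries.coeff s (invOneAdd k β ^ (j : ℕ)) * PowerSeries.coeff t (PowerSeries.X ^ partExp μ n i *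
        (1 + PowerSeries.C β * PowerSeries.X) ^ (i : ℕ))), dualPoly, map_sum]
  refine Finset.sum_congr rfl fun m _ => ?_
  rw [map_smul, polyPair_X_pow_right, smul_eq_mul, ← Polynomial.coeff_coe, grothPoly]
  simp

lemma pairEntry_eq_zero_of_lt {a b : ℕ} (h : b < a) (i j : ℕ) : pairEntry k β a b i j = 0 := by
  rw [pairEntry, PowerSeries.coeff_X_pow_mul', if_neg (not_le.2 h)]

lemma one_add_pow_mul_invOneAdd_pow {i j : ℕ} (h : j ≤ i) :
    (1 + PowerSeries.C β * PowerSeries.X) ^ i * invOneAdd k β ^ j =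
      (1 + PowerSeries.C β * PowerSeries.X) ^ (i - j) := by
  obtain ⟨t, rfl⟩ := Nat.exists_eq_add_of_le' h
  rw [pow_add, mul_assoc, ← mul_pow, one_add_mul_invOneAdd, one_pow, mul_one, Nat.add_sub_cancel]

lemma pairEntry_self (a b i : ℕ) : pairEntry k β a b i i = if b = a then 1 else 0 := by
  rw [pairEntry, one_add_pow_mul_invOneAdd_pow k β le_rfl, Nat.sub_self, pow_zero, mul_one,
    PowerSeries.coeff_X_pow]

lemma pairEntry_eq_zero_of_gt {a b i j : ℕ} (hij : j ≤ i) (h : a + (i - j) < b) :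
    pairEntry k β a b i j = 0 := by
  rw [pairEntry, one_add_pow_mul_invOneAdd_pow k β hij]
  have : (PowerSeries.X ^ a * (1 + PowerSeries.C β * PowerSeries.X) ^ (i - j) : PowerSeries k) =
      ((Polynomial.X ^ a * (1 + Polynomial.C β * Polynomial.X) ^ (i - j) : Polynomial k) :
        PowerSeries k) := by simp
  rw [this, Polynomial.coeff_coe]
  refine Polynomial.coeff_eq_zero_of_natDegree_lt (lt_of_le_of_lt ?_ h)
  refine Polynomial.natDegree_mul_le.trans (Nat.add_le_add (Polynomial.natDegree_X_pow_le a) ?_)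
  refine Polynomial.natDegree_pow_le.trans ?_
  calc (i - j) * (1 + Polynomial.C β * Polynomial.X : Polynomial k).natDegree ≤ (i - j) * 1 :=
        Nat.mul_le_mul_left _ (by compute_degree)
    _ = i - j := mul_one _

/-- A permutation avoiding the zero block would inject the `p + 1` indices `≤ p` into the `p`
indices `< p`. -/
lemma det_eq_zero_of_block {n : ℕ} (A : Matrix (Fin n) (Fin n) k) (p : Fin n)
    (h : ∀ i j, p ≤ i → j ≤ p → A i j = 0) : A.det = 0 := by
  rw [Matrix.det_apply']
  refine Finset.sum_eq_zero fun σ _ => ?_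
  obtain ⟨j, hj, hσ⟩ : ∃ j, j ≤ p ∧ p ≤ σ j := by
    by_contra hcon
    push Not at hcon
    have h1 := Finset.card_le_card_of_injOn (s := Finset.Iic p) (t := Finset.Iio p) σ
      (fun j hj => by
        rw [Finset.mem_coe, Finset.mem_Iic] at hj
        rw [Finset.mem_coe, Finset.mem_Iio]
        exact hcon j hj) σ.injective.injOn
    rw [Fin.card_Iic, Fin.card_Iio] at h1
    omega
  rw [Finset.prod_eq_zero (f := fun i => A (σ i) i) (Finset.mem_univ j) (h _ _ hσ hj), mul_zero]

-- Let `a`, `b` be the shifted parts and `p` a place where they differ. If `a_p > b_p`, then `b_j <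
-- a_i` for `i ≤ p ≤ j`. If `a_p < b_p`, then for `j ≤ p ≤ i` strict decrease gives `a_i + (i - j) <
-- b_j`, beyond the degree of `z^{a_i} (1 + β z)^{i - j}`. Either way a zero block touches the
-- diagonal at `p`.
open Classical in
lemma det_pairEntry {μ ν : YoungDiagram} {n : ℕ} (hμ : μ.colLen 0 ≤ n) (hν : ν.colLen 0 ≤ n) :
    (Matrix.of fun i j : Fin n => pairEntry k β (partExp μ n i) (partExp ν n j) i j).det =
      if μ = ν then 1 else 0 := by
  have ha := partExp_strictAnti μ n
  have hb := partExp_strictAnti ν n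
  split_ifs with h
  · subst h
    rw [Matrix.det_of_isLowerTriangular]
    · exact Finset.prod_eq_one fun i _ => by rw [Matrix.of_apply, pairEntry_self, if_pos rfl]
    · intro i j hij
      exact pairEntry_eq_zero_of_lt k β (ha (OrderDual.toDual_lt_toDual.1 hij)) _ _
  · obtain ⟨p, hp⟩ : ∃ p, partExp μ n p ≠ partExp ν n p := by
      by_contra hcon
      push Not at hcon
      exact h (partExp_injective hμ hν (funext hcon))
    rcases lt_or_gt_of_ne hp with hlt | hlt
    · refine det_eq_zero_of_block k _ p fun i j hi hj => ?_
      have hi' : (p : ℕ) ≤ i := hi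
      have hj' : (j : ℕ) ≤ p := hj
      have h1 := add_le_of_strictAnti ha ((i : ℕ) - p) p i (by omega)
      have h2 := add_le_of_strictAnti hb ((p : ℕ) - j) j p (by omega)
      exact pairEntry_eq_zero_of_gt k β (by omega) (by omega)
    · rw [← Matrix.det_transpose]
      refine det_eq_zero_of_block k _ p fun j i hj hi => ?_
      exact pairEntry_eq_zero_of_lt k β
        ((hb.antitone hj).trans_lt (hlt.trans_le (ha.antitone hi))) _ _

lemma coeff_grothPoly_of_lt {μ : YoungDiagram} {n b : ℕ} {i : Fin n} (h : b < partExp μ n i) :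
    (grothPoly k β μ n i).coeff b = 0 := by
  rw [grothPoly, Polynomial.coeff_X_pow_mul', if_neg (not_le.2 h)]

lemma coeff_grothPoly_self (μ : YoungDiagram) (n : ℕ) (i : Fin n) :
    (grothPoly k β μ n i).coeff (partExp μ n i) = 1 := by
  rw [grothPoly, Polynomial.coeff_X_pow_mul', if_pos le_rfl, Nat.sub_self]
  simp [Polynomial.coeff_zero_eq_eval_zero]

variable [CharZero k]

open Classical in
lemma hallPairing_dualGrothendieck (μ ν : YoungDiagram) (r : ℕ) (hr : ν.colLen 0 ≤ r) :
    hallPairing k (stableGrothendieck k β μ) (dualGrothendieck k β ν r) =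
      if μ = ν then 1 else 0 := by
  obtain ⟨n, hn, hrn⟩ : ∃ n, μ.colLen 0 ≤ n ∧ r ≤ n :=
    ⟨max (μ.colLen 0) r, le_max_left _ _, le_max_right _ _⟩
  rw [← dualGrothendieck_of_le k β hr hrn, dualGrothendieck_eq_jt,
    hallPairing_stableGrothendieck k β hn (jt_mem_shortPart k _), grothLift, hallInner_jt]
  simp only [polyPair_grothPoly_dualPoly]
  exact det_pairEntry k β hn (hr.trans hrn)

/-! ### Nondegeneracy -/

open Classical in
/-- The expansion of `G_μ` into Schur functions is unitriangular with respect to the size. -/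
lemma hallInner_grothLift_schur {μ ν : YoungDiagram} {n : ℕ} (hμ : μ.colLen 0 ≤ n)
    (hν : ν.colLen 0 ≤ n) (h : ∑ i : Fin n, ν.rowLen i ≤ ∑ i : Fin n, μ.rowLen i) :
    hallInner k (grothLift k β μ n) (schur k ν) = if ν = μ then 1 else 0 := by
  rw [grothLift, schur_eq_jt k hν, hallInner_jt, Matrix.det_apply']
  simp only [Matrix.of_apply, polyPair_X_pow_right]
  have hsum : ∑ i, partExp ν n i ≤ ∑ i, partExp μ n i := by
    rw [sum_partExp, sum_partExp]
    omega
  -- The lowest exponent in `grothPoly` is the shifted part of `μ`, so a nonzero product forces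
  -- `partExp μ n (σ i) ≤ partExp ν n i` for all `i`. The size hypothesis makes all of these
  -- equalities.
  have key : ∀ σ : Equiv.Perm (Fin n),
      ∏ i, (grothPoly k β μ n (σ i)).coeff (partExp ν n i) ≠ 0 → σ = 1 ∧ ν = μ := by
    intro σ hσ
    have h1 : ∀ i, partExp μ n (σ i) ≤ partExp ν n i := by
      intro i
      by_contra hlt
      exact hσ (Finset.prod_eq_zero (Finset.mem_univ i) (coeff_grothPoly_of_lt k β (not_le.1 hlt)))
    have h2 : ∑ i, partExp μ n (σ i) = ∑ i, partExp ν n i := by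
      refine le_antisymm (Finset.sum_le_sum fun i _ => h1 i) ?_
      rwa [Equiv.sum_comp σ (partExp μ n)]
    have h3 : ∀ i, partExp μ n (σ i) = partExp ν n i := fun i =>
      (Finset.sum_eq_sum_iff_of_le fun i _ => h1 i).1 h2 i (Finset.mem_univ i)
    have h4 := perm_eq_one_of_strictAnti (partExp_strictAnti μ n) (partExp_strictAnti ν n) h3
    refine ⟨h4, partExp_injective hν hμ (funext fun i => ?_)⟩
    rw [← h3, h4, Equiv.Perm.one_apply]
  split_ifs with hνμ
  · subst hνμ
    rw [Finset.sum_eq_single 1]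
    · simp [coeff_grothPoly_self]
    · intro σ _ hσ
      by_contra hne
      exact hσ (key σ (right_ne_zero_of_mul hne)).1
    · simp
  · refine Finset.sum_eq_zero fun σ _ => ?_
    by_contra hne
    exact hνμ (key σ (right_ne_zero_of_mul hne)).2

/-- For `μ` of maximal size among the Schur functions occurring in `f`, unitriangularity leaves only
the coefficient of `s_μ` in the pairing with `G_μ`. -/
lemma eq_zero_of_hallPairing_eq_zero {f : SymFun k}
    (h : ∀ μ, hallPairing k (stableGrothendieck k β μ) f = 0) : f = 0 := by
  classical
  by_contra hf
  set c := (schurBasis k).repr f with hc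
  have hsupp : c.support.Nonempty := by
    rw [Finsupp.support_nonempty_iff]
    intro h0
    exact hf ((schurBasis k).repr.map_eq_zero_iff.1 h0)
  obtain ⟨n, hn⟩ := exists_colLen_lt k f
  obtain ⟨μ, hμ, hmax⟩ := c.support.exists_max_image (fun μ => ∑ i : Fin n, μ.rowLen i) hsupp
  have hfsum : f = ∑ ν ∈ c.support, c ν • schur k ν := by
    conv_lhs => rw [← (schurBasis k).linearCombination_repr f, Finsupp.linearCombination_apply]
    simp only [schurBasis_apply]
    rfl
  have hshort : f ∈ shortPart k n := by
    rw [hfsum]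
    exact Submodule.sum_mem _ fun ν hν => Submodule.smul_mem _ _
      (Submodule.subset_span ⟨ν, (hn ν hν).le, rfl⟩)
  have h1 := h μ
  rw [hallPairing_stableGrothendieck k β (hn μ hμ).le hshort, hfsum, map_sum,
    Finset.sum_eq_single μ] at h1
  · rw [map_smul, hallInner_grothLift_schur k β (hn μ hμ).le (hn μ hμ).le le_rfl, if_pos rfl,
      smul_eq_mul, mul_one] at h1
    exact Finsupp.mem_support_iff.1 hμ h1
  · intro ν hν hne
    rw [map_smul, hallInner_grothLift_schur k β (hn μ hμ).le (hn ν hν).le (hmax ν hν), if_neg hne,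
      smul_zero]
  · intro h'
    exact absurd hμ h'

end Matrix

end StableGrothendieck
end

open Classical in
theorem mainTheorem4 (k : Type*) [Field k] [CharZero k] (β : k) :
    -- the extended Hall inner product and the stable Grothendieck polynomials are well defined
    (∃! B, StableGrothendieck.IsHallPairing k B) ∧
    (∀ μ : YoungDiagram, ∃! G, StableGrothendieck.IsStableGrothendieck k β μ G) ∧
    -- duality
    (∀ (μ ν : YoungDiagram) (r : ℕ), ν.colLen 0 ≤ r →
      StableGrothendieck.hallPairing k (StableGrothendieck.stableGrothendieck k β μ)
        (StableGrothendieck.dualGrothendieck k β ν r) = if μ = ν then 1 else 0) ∧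
    -- the dual stable Grothendieck polynomial is the only symmetric function with this property
    (∀ (ν : YoungDiagram) (r : ℕ), ν.colLen 0 ≤ r → ∀ f : StableGrothendieck.SymFun k,
      (∀ μ : YoungDiagram,
        StableGrothendieck.hallPairing k (StableGrothendieck.stableGrothendieck k β μ) f =
          if μ = ν then 1 else 0) →
      f = StableGrothendieck.dualGrothendieck k β ν r) := by
  refine ⟨StableGrothendieck.existsUnique_isHallPairing k,
    StableGrothendieck.existsUnique_isStableGrothendieck k β,
    StableGrothendieck.hallPairing_dualGrothendieck k β, fun ν r hr f hf => ?_⟩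
  rw [← sub_eq_zero]
  refine StableGrothendieck.eq_zero_of_hallPairing_eq_zero k β fun μ => ?_
  rw [map_sub, hf μ, StableGrothendieck.hallPairing_dualGrothendieck k β μ ν r hr, sub_self]
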